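/- **Conventions.** Let $\mathbb O$ be the real algebra of octonions with basis $e_0=1,e_1,\dots,e_7$ and $e_ie_j=\sum_k\epsilon_{ijk}e_k-\delta_{ij}$ for $i,j\ge 1$, where $\epsilon$ is skew-symmetric and belongs to the $3$-form $e^{123}+e^{145}+e^{167}+e^{246}-e^{257}-e^{347}-e^{356}$. An *$\mathbb O$-bimodule* is a real vector space $M$ (of any dimension) with $\mathbb R$-bilinear left and right multiplications by octonions such that, for all $p,q\in\mathbb O$ and $m\in M$, $1m=m$, $[p,q,m]=-[q,p,m]$ and $[p,q,m]=[m,p,q]=[q,m,p]$, where $[p,q,m]=(pq)m-p(qm)$, $[m,p,q]=(mp)q-m(pq)$ and $[q,m,p]=(qm)p-q(mp)$. Put $\mathrm{Re}\,M=\{m\in M:[p,q,m]=0\text{ for all }p,q\in\mathbb O\}$ and $\mathrm{Re}\,x=\frac5{12}x-\frac1{12}\sum_{i=1}^7e_ixe_i$ for $x\in M$; the map $\mathrm{Re}$ is the projection of $M=\bigoplus_{i=0}^7e_i\,\mathrm{Re}\,M$ onto $\mathrm{Re}\,M$. For an $\mathbb R$-linear map $f:M\to M'$ of $\mathbb O$-bimodules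 put $A_p(x,f)=f(px)-pf(x)$. The map $f$ is *left para-linear* if $\mathrm{Re}\,A_p(x,f)=0$ for all $p\in\mathbb O$, $x\in M$. The set $\mathrm{Hom}_{\mathcal{LO}}(M,M')$ of these maps is an $\mathbb O$-bimodule with $$(r\odot f)(x)=f(xr)+A_r(x,f),\qquad (f\odot r)(x)=f(x)r-A_r(x,f).$$ The *regular composition* of $g\in\mathrm{Hom}_{\mathcal{LO}}(M,M')$ and $f\in\mathrm{Hom}_{\mathcal{LO}}(M',M'')$ is $$(f\circledcirc g)(x)=f(g(x))-\sum_{j=1}^7e_j\,\mathrm{Re}\bigl(f(A_{e_j}(x,g))\bigr)\in\mathrm{Hom}_{\mathcal{LO}}(M,M'').$$ A *non-associative category* has objects, morphisms, compositions and two-sided identities, but composition need not be associative; a *functor* preserves compositions and identities. A pair of functors $F:\mathcal C\to\mathcal D$, $G:\mathcal D\to\mathcal C$ between such categories is an *adjoint pair* if there are bijections $\tau_{C,D}:\mathrm{Hom}_{\mathcal D}(FC,D)\to\mathrm{Hom}_{\mathcal C}(C,GD)$, for all objects $C,D$, with $\tau_{C',D}(\alpha\,F(f))=\tau_{C,D}(\alpha)\,f$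 and $\tau_{C,D'}(g\,\alpha)=G(g)\,\tau_{C,D}(\alpha)$ for all $\alpha:FC\to D$, $f:C'\to C$ and $g:D\to D'$. Let $\mathcal{LO}$ be the non-associative category of $\mathbb O$-bimodules, left para-linear maps and regular compositions. For $\mathbb O$-bimodules $M,X$ put $M\otimes_{\mathbb O}X=(\mathrm{Re}\,M\otimes_{\mathbb R}\mathrm{Re}\,X)\otimes_{\mathbb R}\mathbb O$, with $p(v\otimes q)=v\otimes pq$ and $(v\otimes q)p=v\otimes qp$. For $m=\sum_ie_im_i\in M$ and $x=\sum_je_jx_j\in X$ with $m_i\in\mathrm{Re}\,M$, $x_j\in\mathrm{Re}\,X$, put $m\otimes_{\mathbb O}x=\sum_{i,j=0}^7(m_i\otimes x_j)\otimes e_ie_j$. The functor $M\otimes^{ll}_{\mathbb O}-:\mathcal{LO}\to\mathcal{LO}$ sends $X$ to $M\otimes_{\mathbb O}X$, and $f:X\to X'$ to the left para-linear map $1_M\otimes^{ll}f:M\otimes_{\mathbb O}X\to M\otimes_{\mathbb O}X'$ given by $(m\otimes x)\otimes q\mapsto q\,(m\otimes_{\mathbb O}f(x))$ for $m\in\mathrm{Re}\,M$,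 $x\in\mathrm{Re}\,X$, $q\in\mathbb O$. The functor $\mathrm{Hom}_{\mathcal{LO}}(M,-):\mathcal{LO}\to\mathcal{LO}$ sends $Y$ to $\mathrm{Hom}_{\mathcal{LO}}(M,Y)$, and $g:Y\to Y'$ to $\mathrm{Hom}_{\mathcal{LO}}(M,g):h\mapsto g\circledcirc h$. **Theorem.** Let $M$ be an $\mathbb O$-bimodule. Then $(M\otimes^{ll}_{\mathbb O}-,\ \mathrm{Hom}_{\mathcal{LO}}(M,-))$ is an adjoint pair. More precisely, there are isomorphisms of $\mathbb O$-bimodules $$\tau_{X,Y}:\mathrm{Hom}_{\mathcal{LO}}(M\otimes_{\mathbb O}X,Y)\to\mathrm{Hom}_{\mathcal{LO}}(X,\mathrm{Hom}_{\mathcal{LO}}(M,Y)),$$ one for each pair of $\mathbb O$-bimodules $X,Y$, such that for all $\alpha\in\mathrm{Hom}_{\mathcal{LO}}(M\otimes_{\mathbb O}X,Y)$ and all left para-linear maps $f:X'\to X$ and $g:Y\to Y'$, $$\tau_{X',Y}\bigl(\alpha\circledcirc(1_M\otimes^{ll}f)\bigr)=\tau_{X,Y}(\alpha)\circledcirc f,\qquad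 \tau_{X,Y'}(g\circledcirc\alpha)=\mathrm{Hom}_{\mathcal{LO}}(M,g)\circledcirc\tau_{X,Y}(\alpha).$$ -/

import Mathlib

/-- The real vector space underlying the octonions: `x i` is the coefficient of `e i`. -/
def Octonion : Type := Fin 8 → ℝ

namespace Octonion

noncomputable instance : AddCommGroup Octonion := inferInstanceAs (AddCommGroup (Fin 8 → ℝ))

noncomputable instance : Module ℝ Octonion := inferInstanceAs (Module ℝ (Fin 8 → ℝ))

/-- The standard basis `e 0 = 1, e 1, …, e 7`. -/
noncomputable def e (i : Fin 8) : Octonion := (Pi.single i (1 : ℝ) : Fin 8 → ℝ)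

noncomputable instance : One Octonion := ⟨e 0⟩

/-- Octonion multiplication: `eᵢ eⱼ = εᵢⱼₖ eₖ - δᵢⱼ` with `ε` the skew-symmetric symbol of the 3-form
`e¹²³ + e¹⁴⁵ + e¹⁶⁷ + e²⁴⁶ - e²⁵⁷ - e³⁴⁷ - e³⁵⁶`. -/
noncomputable instance : Mul Octonion := ⟨fun x y => (![
  x 0 * y 0 - x 1 * y 1 - x 2 * y 2 - x 3 * y 3 - x 4 * y 4 - x 5 * y 5 - x 6 * y 6 - x 7 * y 7,
  x 0 * y 1 + x 1 * y 0 + (x 2 * y 3 - x 3 * y 2) + (x 4 * y 5 - x 5 * y 4) + (x 6 * y 7 - x 7 * y 6),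
  x 0 * y 2 + x 2 * y 0 + (x 3 * y 1 - x 1 * y 3) + (x 4 * y 6 - x 6 * y 4) + (x 7 * y 5 - x 5 * y 7),
  x 0 * y 3 + x 3 * y 0 + (x 1 * y 2 - x 2 * y 1) + (x 7 * y 4 - x 4 * y 7) + (x 6 * y 5 - x 5 * y 6),
  x 0 * y 4 + x 4 * y 0 + (x 5 * y 1 - x 1 * y 5) + (x 6 * y 2 - x 2 * y 6) + (x 3 * y 7 - x 7 * y 3),
  x 0 * y 5 + x 5 * y 0 + (x 1 * y 4 - x 4 * y 1) + (x 2 * y 7 - x 7 * y 2) + (x 3 * y 6 - x 6 * y 3),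
  x 0 * y 6 + x 6 * y 0 + (x 7 * y 1 - x 1 * y 7) + (x 2 * y 4 - x 4 * y 2) + (x 5 * y 3 - x 3 * y 5),
  x 0 * y 7 + x 7 * y 0 + (x 1 * y 6 - x 6 * y 1) + (x 5 * y 2 - x 2 * y 5) + (x 4 * y 3 - x 3 * y 4)]
  : Fin 8 → ℝ)⟩

theorem add_apply (x y : Octonion) (i : Fin 8) : (x + y) i = x i + y i := rfl
theorem sub_apply (x y : Octonion) (i : Fin 8) : (x - y) i = x i - y i := rfl
theorem neg_apply (x : Octonion) (i : Fin 8) : (-x) i = -x i := rfl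
theorem smul_apply (r : ℝ) (x : Octonion) (i : Fin 8) : (r • x) i = r * x i := rfl
theorem zero_apply (i : Fin 8) : (0 : Octonion) i = 0 := rfl
theorem e_apply (i j : Fin 8) : e i j = if j = i then 1 else 0 := Pi.single_apply i 1 j
theorem one_eq : (1 : Octonion) = e 0 := rfl

theorem mul_apply0 (x y : Octonion) : (x * y) 0 = x 0 * y 0 - x 1 * y 1 - x 2 * y 2 - x 3 * y 3
    - x 4 * y 4 - x 5 * y 5 - x 6 * y 6 - x 7 * y 7 := rfl
theorem mul_apply1 (x y : Octonion) : (x * y) 1 = x 0 * y 1 + x 1 * y 0 + (x 2 * y 3 - x 3 * y 2)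
    + (x 4 * y 5 - x 5 * y 4) + (x 6 * y 7 - x 7 * y 6) := rfl
theorem mul_apply2 (x y : Octonion) : (x * y) 2 = x 0 * y 2 + x 2 * y 0 + (x 3 * y 1 - x 1 * y 3)
    + (x 4 * y 6 - x 6 * y 4) + (x 7 * y 5 - x 5 * y 7) := rfl
theorem mul_apply3 (x y : Octonion) : (x * y) 3 = x 0 * y 3 + x 3 * y 0 + (x 1 * y 2 - x 2 * y 1)
    + (x 7 * y 4 - x 4 * y 7) + (x 6 * y 5 - x 5 * y 6) := rfl
theorem mul_apply4 (x y : Octonion) : (x * y) 4 = x 0 * y 4 + x 4 * y 0 + (x 5 * y 1 - x 1 * y 5)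
    + (x 6 * y 2 - x 2 * y 6) + (x 3 * y 7 - x 7 * y 3) := rfl
theorem mul_apply5 (x y : Octonion) : (x * y) 5 = x 0 * y 5 + x 5 * y 0 + (x 1 * y 4 - x 4 * y 1)
    + (x 2 * y 7 - x 7 * y 2) + (x 3 * y 6 - x 6 * y 3) := rfl
theorem mul_apply6 (x y : Octonion) : (x * y) 6 = x 0 * y 6 + x 6 * y 0 + (x 7 * y 1 - x 1 * y 7)
    + (x 2 * y 4 - x 4 * y 2) + (x 5 * y 3 - x 3 * y 5) := rfl
theorem mul_apply7 (x y : Octonion) : (x * y) 7 = x 0 * y 7 + x 7 * y 0 + (x 1 * y 6 - x 6 * y 1)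
    + (x 5 * y 2 - x 2 * y 5) + (x 4 * y 3 - x 3 * y 4) := rfl

theorem ext8 {x y : Octonion} (h0 : x 0 = y 0) (h1 : x 1 = y 1) (h2 : x 2 = y 2) (h3 : x 3 = y 3)
    (h4 : x 4 = y 4) (h5 : x 5 = y 5) (h6 : x 6 = y 6) (h7 : x 7 = y 7) : x = y := by
  funext i
  fin_cases i <;> assumption

theorem mul_add' (x y z : Octonion) : x * (y + z) = x * y + x * z := by
  apply ext8 <;> simp only [add_apply, mul_apply0, mul_apply1, mul_apply2, mul_apply3, mul_apply4,
    mul_apply5, mul_apply6, mul_apply7] <;> ring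

theorem add_mul' (x y z : Octonion) : (x + y) * z = x * z + y * z := by
  apply ext8 <;> simp only [add_apply, mul_apply0, mul_apply1, mul_apply2, mul_apply3, mul_apply4,
    mul_apply5, mul_apply6, mul_apply7] <;> ring

theorem smul_mul' (r : ℝ) (x y : Octonion) : (r • x) * y = r • (x * y) := by
  apply ext8 <;> simp only [smul_apply, mul_apply0, mul_apply1, mul_apply2, mul_apply3, mul_apply4,
    mul_apply5, mul_apply6, mul_apply7] <;> ring

theorem mul_smul' (r : ℝ) (x y : Octonion) : x * (r • y) = r • (x * y) := by
  apply ext8 <;> simp only [smul_apply, mul_apply0, mul_apply1, mul_apply2, mul_apply3, mul_apply4,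
    mul_apply5, mul_apply6, mul_apply7] <;> ring

theorem one_mul' (x : Octonion) : 1 * x = x := by
  apply ext8 <;> simp [one_eq, e_apply, mul_apply0, mul_apply1, mul_apply2, mul_apply3, mul_apply4,
    mul_apply5, mul_apply6, mul_apply7]

theorem mul_one' (x : Octonion) : x * 1 = x := by
  apply ext8 <;> simp [one_eq, e_apply, mul_apply0, mul_apply1, mul_apply2, mul_apply3, mul_apply4,
    mul_apply5, mul_apply6, mul_apply7]

noncomputable instance : NonAssocRing Octonion :=
  { (inferInstance : AddCommGroup Octonion), (inferInstance : Mul Octonion),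
    (inferInstance : One Octonion) with
    left_distrib := mul_add'
    right_distrib := add_mul'
    zero_mul := fun x => by simpa using smul_mul' 0 0 x
    mul_zero := fun x => by simpa using mul_smul' 0 x 0
    one_mul := one_mul'
    mul_one := mul_one' }

instance : IsScalarTower ℝ Octonion Octonion := ⟨smul_mul'⟩

instance : SMulCommClass ℝ Octonion Octonion := ⟨fun r x y => (mul_smul' r x y).symm⟩

/-- Octonion conjugation. -/
noncomputable def conj (x : Octonion) : Octonion := (2 * x 0) • (1 : Octonion) - x

theorem eq_sum (x : Octonion) : x = ∑ i : Fin 8, x i • e i := by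
  simp only [Fin.sum_univ_eight]
  apply ext8 <;> simp [add_apply, smul_apply, e_apply]

/-- The octonions are alternative: the associator is skew in its first two arguments. -/
theorem assoc_skew (p q r : Octonion) :
    p * q * r - p * (q * r) = -(q * p * r - q * (p * r)) := by
  apply ext8 <;> simp only [sub_apply, neg_apply, mul_apply0, mul_apply1, mul_apply2, mul_apply3,
    mul_apply4, mul_apply5, mul_apply6, mul_apply7] <;> ring

/-- The associator is invariant under cyclic permutations. -/
theorem assoc_cycl (p q r : Octonion) :
    p * q * r - p * (q * r) = r * p * q - r * (p * q) := by
  apply ext8 <;> simp only [sub_apply, mul_apply0, mul_apply1, mul_apply2, mul_apply3,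
    mul_apply4, mul_apply5, mul_apply6, mul_apply7] <;> ring

theorem mul_conj_e_apply_zero (p : Octonion) (i : Fin 8) : (conj (e i) * p) 0 = p i := by
  fin_cases i <;> simp [conj, one_eq, sub_apply, neg_apply, smul_apply, e_apply, mul_apply0]
  ring

theorem sum_e_mul_mul_e (p : Octonion) :
    (5 / 12 : ℝ) • p - (1 / 12 : ℝ) • ∑ i : Fin 7, e i.succ * p * e i.succ = p 0 • (1 : Octonion) := by
  simp only [Fin.sum_univ_seven]
  apply ext8 <;> simp [add_apply, smul_apply, e_apply, sub_apply, one_eq, mul_apply0, mul_apply1,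
    mul_apply2, mul_apply3, mul_apply4, mul_apply5, mul_apply6, mul_apply7, Fin.ext_iff] <;> ring

end Octonion

open Octonion

/-- An `𝕆`-bimodule: a real vector space with real bilinear left and right multiplications by
octonions, the left one being unital and alternative, such that `[p,q,m] = [m,p,q] = [q,m,p]`. Here
`lmul p m` is `p m` and `rmul p m` is `m p`. -/
class OctBimodule (M : Type*) [AddCommGroup M] [Module ℝ M] where
  lmul : Octonion →ₗ[ℝ] M →ₗ[ℝ] M
  rmul : Octonion →ₗ[ℝ] M →ₗ[ℝ] M
  one_lmul : ∀ m, lmul 1 m = m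
  left_alt : ∀ p q m,
    lmul (p * q) m - lmul p (lmul q m) = -(lmul (q * p) m - lmul q (lmul p m))
  assoc_right : ∀ p q m,
    lmul (p * q) m - lmul p (lmul q m) = rmul q (rmul p m) - rmul (p * q) m
  assoc_mid : ∀ p q m,
    lmul (p * q) m - lmul p (lmul q m) = rmul p (lmul q m) - lmul q (rmul p m)

namespace OctBimodule

section Theory

variable {M : Type*} [AddCommGroup M] [Module ℝ M] [OctBimodule M]

/-- The nucleus (the set of associative elements) of a bimodule. -/
noncomputable def nuc (M : Type*) [AddCommGroup M] [Module ℝ M] [OctBimodule M] :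
    Submodule ℝ M where
  carrier := {m | ∀ p q : Octonion, lmul (p * q) m - lmul p (lmul q m) = 0}
  add_mem' := by
    intro a b ha hb p q
    have h1 := ha p q
    have h2 := hb p q
    rw [sub_eq_zero] at h1 h2 ⊢
    simp only [map_add, h1, h2]
  zero_mem' := by intro p q; simp
  smul_mem' := by
    intro c a ha p q
    have h1 := ha p q
    rw [sub_eq_zero] at h1 ⊢
    simp only [map_smul, h1]

/-- The real part operator `Re x = 5/12 x - 1/12 ∑ eᵢ x eᵢ`; by `reL_lmul` and `eq_sum_reL` below it
is the projection onto the first summand of `M = ⨁ eᵢ (nuc M)`. -/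
noncomputable def reL : M →ₗ[ℝ] M :=
  (5 / 12 : ℝ) • LinearMap.id -
    (1 / 12 : ℝ) • ∑ i : Fin 7, (rmul (e i.succ)) ∘ₗ (lmul (e i.succ))

/-! The structure of a bimodule: `M = ⨁ eᵢ (nuc M)` and `nuc M` is the commutative centre. -/

theorem lmul_anti {p q : Octonion} (h : p * q = -(q * p)) (x : M) :
    lmul p (lmul q x) = -lmul q (lmul p x) := by
  have := left_alt p q x
  rw [h] at this
  simp only [map_neg, LinearMap.neg_apply] at this
  have h2 : lmul p (lmul q x) + lmul q (lmul p x) = (0 : M) := by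
    linear_combination (norm := module) (-1 : ℝ) • this
  exact eq_neg_of_add_eq_zero_left h2

theorem lmul_sq {p : Octonion} (h : p * p = -1) (x : M) : lmul p (lmul p x) = -x := by
  have := left_alt p p x
  rw [h] at this
  simp only [map_neg, LinearMap.neg_apply, one_lmul] at this
  have h2 : (2 : ℝ) • (lmul p (lmul p x) + x) = 0 := by
    linear_combination (norm := module) (-1 : ℝ) • this
  have h3 := (smul_eq_zero.1 h2).resolve_left (by norm_num)
  exact eq_neg_of_add_eq_zero_left h3

theorem e_mul_self (i : Fin 7) : e i.succ * e i.succ = -1 := by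
  fin_cases i <;> apply ext8 <;> simp [neg_apply, e_apply, one_eq, mul_apply0, mul_apply1, mul_apply2,
    mul_apply3, mul_apply4, mul_apply5, mul_apply6, mul_apply7, Fin.ext_iff]

/-- `p, q, s` multiply like the quaternion units `i, j, k`. -/
structure QTriple (p q s : Octonion) : Prop where
  pp : p * p = -1
  qq : q * q = -1
  ss : s * s = -1
  pq : p * q = s
  qs : q * s = p
  sp : s * p = q
  qp : q * p = -s
  sq : s * q = -p
  ps : p * s = -q

theorem QTriple.rot {p q s : Octonion} (h : QTriple p q s) : QTriple q s p :=
  ⟨h.qq, h.ss, h.pp, h.qs, h.sp, h.pq, h.sq, h.ps, h.qp⟩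

theorem QTriple.fix {p q s : Octonion} (h : QTriple p q s) (x : M) :
    lmul p (lmul q (lmul s (rmul q x + lmul q x))) = -(rmul q x + lmul q x) := by
  have hpq : ∀ z : M, lmul q (lmul p z) = -lmul p (lmul q z) := lmul_anti (by rw [h.qp, h.pq])
  have hqs : ∀ z : M, lmul s (lmul q z) = -lmul q (lmul s z) := lmul_anti (by rw [h.sq, h.qs])
  have hps : ∀ z : M, lmul s (lmul p z) = -lmul p (lmul s z) := lmul_anti (by rw [h.ps, h.sp, neg_neg])
  have hpp : ∀ z : M, lmul p (lmul p z) = -z := lmul_sq h.pp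
  have hqq : ∀ z : M, lmul q (lmul q z) = -z := lmul_sq h.qq
  have hss : ∀ z : M, lmul s (lmul s z) = -z := lmul_sq h.ss
  have r1 := assoc_mid p q x
  have r2 := assoc_right q s x
  have r3 := assoc_right q s (lmul q x)
  have r4 := assoc_mid q q x
  have r5 := assoc_mid s q (rmul q x)
  rw [h.pq] at r1
  rw [h.qs] at r2 r3
  rw [h.qq, hqq] at r4
  rw [h.sq, hqs] at r5
  simp only [map_neg, LinearMap.neg_apply, one_lmul, sub_self] at r4 r5
  have r4' : rmul q (lmul q x) = lmul q (rmul q x) := sub_eq_zero.1 (by rw [← r4])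
  rw [r4', hqs] at r3
  have r2' := congrArg (lmul q) r2
  simp only [map_sub, map_neg, hpq, hqq] at r2' r3
  have key : lmul q (lmul s (rmul q x)) - lmul p (rmul q x) = lmul p (lmul q x) - lmul s x := by
    linear_combination (norm := module) r5 - r3 + r2' - r1
  have key2 := congrArg (lmul p) key
  simp only [map_sub, hpp] at key2
  simp only [map_add, hqs, map_neg, hqq]
  linear_combination (norm := module) key2

theorem mul_anti {p q : Octonion} (hp : p 0 = 0) (hq : q 0 = 0)
    (h : p 1 * q 1 + p 2 * q 2 + p 3 * q 3 + p 4 * q 4 + p 5 * q 5 + p 6 * q 6 + p 7 * q 7 = 0) :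
    p * q = -(q * p) := by
  apply ext8
  · rw [neg_apply, mul_apply0, mul_apply0, hp, hq]
    linear_combination -2 * h
  all_goals
    simp only [neg_apply, mul_apply1, mul_apply2, mul_apply3, mul_apply4, mul_apply5, mul_apply6,
      mul_apply7, hp, hq]
    ring

theorem e_anti {i j : Fin 8} (hi : i ≠ 0) (hj : j ≠ 0) (hij : i ≠ j) : e i * e j = -(e j * e i) := by
  apply mul_anti
  · rw [e_apply, if_neg hi.symm]
  · rw [e_apply, if_neg hj.symm]
  · have h : ∀ k : Fin 8, e i k * e j k = 0 := by
      intro k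
      rw [e_apply, e_apply]
      by_cases hk : k = i
      · rw [if_neg (fun h => hij (hk.symm.trans h)), mul_zero]
      · rw [if_neg hk, zero_mul]
    simp only [h, add_zero]

theorem QTriple.of_mul {p q s : Octonion} (pp : p * p = -1) (qq : q * q = -1) (ss : s * s = -1)
    (hpq : p * q = -(q * p)) (hqs : q * s = -(s * q)) (hps : p * s = -(s * p)) (h : p * q = s) :
    QTriple p q s := by
  have hz : ∀ x : Octonion, x = -x → x = 0 := fun x hx => by
    have h2 : (2 : ℝ) • x = 0 := by
      rw [two_smul]
      exact add_eq_zero_iff_eq_neg.2 hx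
    exact (smul_eq_zero.1 h2).resolve_left (by norm_num)
  have h1 : q * s = p := by
    have := hz _ (assoc_skew q q p)
    rw [qq, sub_eq_zero, neg_mul, one_mul] at this
    rw [← h, hpq, mul_neg, ← this, neg_neg]
  have h2 : s * p = q := by
    have := hz _ (assoc_skew p p q)
    rw [pp, sub_eq_zero, neg_mul, one_mul, h] at this
    rw [← neg_inj, ← hps, this]
  exact ⟨pp, qq, ss, h, h1, h2, by rw [← h, hpq, neg_neg], by rw [← h1, hqs, neg_neg],
    by rw [← h2, hps]⟩

theorem QTriple.of_e {i j k : Fin 7} (hij : i ≠ j) (hjk : j ≠ k) (hik : i ≠ k)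
    (h : e i.succ * e j.succ = e k.succ) : QTriple (e i.succ) (e j.succ) (e k.succ) :=
  QTriple.of_mul (e_mul_self i) (e_mul_self j) (e_mul_self k)
    (e_anti (Fin.succ_ne_zero _) (Fin.succ_ne_zero _) (by simpa using hij))
    (e_anti (Fin.succ_ne_zero _) (Fin.succ_ne_zero _) (by simpa using hjk))
    (e_anti (Fin.succ_ne_zero _) (Fin.succ_ne_zero _) (by simpa using hik)) h

theorem qt123 : QTriple (e 1) (e 2) (e 3) :=
  QTriple.of_e (i := 0) (j := 1) (k := 2) (by decide) (by decide) (by decide) (by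
    apply ext8 <;> simp [e_apply, mul_apply0, mul_apply1, mul_apply2, mul_apply3, mul_apply4,
      mul_apply5, mul_apply6, mul_apply7, Fin.ext_iff])

theorem qt145 : QTriple (e 1) (e 4) (e 5) :=
  QTriple.of_e (i := 0) (j := 3) (k := 4) (by decide) (by decide) (by decide) (by
    apply ext8 <;> simp [e_apply, mul_apply0, mul_apply1, mul_apply2, mul_apply3, mul_apply4,
      mul_apply5, mul_apply6, mul_apply7, Fin.ext_iff])

theorem qt167 : QTriple (e 1) (e 6) (e 7) :=
  QTriple.of_e (i := 0) (j := 5) (k := 6) (by decide) (by decide) (by decide) (by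
    apply ext8 <;> simp [e_apply, mul_apply0, mul_apply1, mul_apply2, mul_apply3, mul_apply4,
      mul_apply5, mul_apply6, mul_apply7, Fin.ext_iff])

theorem qt246 : QTriple (e 2) (e 4) (e 6) :=
  QTriple.of_e (i := 1) (j := 3) (k := 5) (by decide) (by decide) (by decide) (by
    apply ext8 <;> simp [e_apply, mul_apply0, mul_apply1, mul_apply2, mul_apply3, mul_apply4,
      mul_apply5, mul_apply6, mul_apply7, Fin.ext_iff])

theorem qt275 : QTriple (e 2) (e 7) (e 5) :=
  QTriple.of_e (i := 1) (j := 6) (k := 4) (by decide) (by decide) (by decide) (by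
    apply ext8 <;> simp [e_apply, mul_apply0, mul_apply1, mul_apply2, mul_apply3, mul_apply4,
      mul_apply5, mul_apply6, mul_apply7, Fin.ext_iff])

theorem qt374 : QTriple (e 3) (e 7) (e 4) :=
  QTriple.of_e (i := 2) (j := 6) (k := 3) (by decide) (by decide) (by decide) (by
    apply ext8 <;> simp [e_apply, mul_apply0, mul_apply1, mul_apply2, mul_apply3, mul_apply4,
      mul_apply5, mul_apply6, mul_apply7, Fin.ext_iff])

theorem qt365 : QTriple (e 3) (e 6) (e 5) :=
  QTriple.of_e (i := 2) (j := 5) (k := 4) (by decide) (by decide) (by decide) (by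
    apply ext8 <;> simp [e_apply, mul_apply0, mul_apply1, mul_apply2, mul_apply3, mul_apply4,
      mul_apply5, mul_apply6, mul_apply7, Fin.ext_iff])

theorem QTriple.comm_aux {p q s p' s' : Octonion} (h : QTriple p q s) (h' : QTriple p' q s')
    (hp : p * p' = -(p' * p)) (hs : s * p' = -(p' * s)) {y : M} (hy : y ∈ nuc M) :
    rmul q y = lmul q y := by
  have hpq : ∀ z : M, lmul q (lmul p z) = -lmul p (lmul q z) := lmul_anti (by rw [h.qp, h.pq])
  have hps : ∀ z : M, lmul s (lmul p z) = -lmul p (lmul s z) :=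
    lmul_anti (by rw [h.ps, h.sp, neg_neg])
  have hpq' : ∀ z : M, lmul q (lmul p' z) = -lmul p' (lmul q z) :=
    lmul_anti (by rw [h'.qp, h'.pq])
  have hpp : ∀ z : M, lmul p (lmul p' z) = -lmul p' (lmul p z) := lmul_anti hp
  have hss : ∀ z : M, lmul s (lmul p' z) = -lmul p' (lmul s z) := lmul_anti hs
  have hy2 : ∀ a, rmul q (lmul a y) = lmul a (rmul q y) := fun a => by
    have := assoc_mid q a y
    rw [hy q a] at this
    exact (sub_eq_zero.1 this.symm)
  have f1 := h.fix (lmul p y)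
  have f2 := h.fix (lmul p' y)
  rw [hy2, hpq, ← sub_eq_add_neg, ← map_sub] at f1
  rw [hy2, hpq', ← sub_eq_add_neg, ← map_sub] at f2
  set d := rmul q y - lmul q y with hd
  have g1 : lmul p (lmul q (lmul s d)) = -d := by
    have h1 : lmul p (lmul p (lmul q (lmul s d)) + d) = 0 := by
      simp only [hps, hpq, map_neg, neg_neg] at f1
      rw [map_add, f1, neg_add_cancel]
    have h2 := congrArg (lmul p) h1
    rw [lmul_sq h.pp, map_zero, neg_eq_zero] at h2
    exact eq_neg_of_add_eq_zero_left h2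
  have g2 : lmul p (lmul q (lmul s d)) = d := by
    have h1 : lmul p' (lmul p (lmul q (lmul s d)) - d) = 0 := by
      simp only [hpp, hss, hpq', map_neg, neg_neg, neg_inj] at f2
      rw [map_sub, f2, sub_self]
    have h2 := congrArg (lmul p') h1
    rw [lmul_sq h'.pp, map_zero, neg_eq_zero] at h2
    exact sub_eq_zero.1 h2
  have h0 : (2 : ℝ) • d = 0 := by
    linear_combination (norm := module) g1 - g2
  exact sub_eq_zero.1 ((smul_eq_zero.1 h0).resolve_left (by norm_num))

end Theory
end OctBimodule

namespace OctBimodule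

section Theory

set_option linter.unusedSimpArgs false

variable {M : Type*} [AddCommGroup M] [Module ℝ M] [OctBimodule M]

/-- Sorting rule for products of left multiplications by imaginary units. -/
theorem e_swap {i j : Fin 8} (hi : i ≠ 0) (hij : i < j) (x : M) :
    lmul (e j) (lmul (e i) x) = -lmul (e i) (lmul (e j) x) := by
  refine lmul_anti (e_anti ?_ hi hij.ne') x
  intro h
  subst h
  simp at hij

theorem e_sq {i : Fin 8} (hi : i ≠ 0) (x : M) : lmul (e i) (lmul (e i) x) = -x := by
  obtain ⟨k, rfl⟩ := Fin.exists_succ_eq.2 hi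
  exact lmul_sq (e_mul_self k) x

theorem sq1 (x : M) : lmul (e 1) (lmul (e 1) x) = -x := e_sq (by decide) x
theorem sq2 (x : M) : lmul (e 2) (lmul (e 2) x) = -x := e_sq (by decide) x
theorem sw21 (x : M) : lmul (e 2) (lmul (e 1) x) = -lmul (e 1) (lmul (e 2) x) :=
  e_swap (by decide) (by decide) x
theorem sq3 (x : M) : lmul (e 3) (lmul (e 3) x) = -x := e_sq (by decide) x
theorem sw31 (x : M) : lmul (e 3) (lmul (e 1) x) = -lmul (e 1) (lmul (e 3) x) :=
  e_swap (by decide) (by decide) x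
theorem sw32 (x : M) : lmul (e 3) (lmul (e 2) x) = -lmul (e 2) (lmul (e 3) x) :=
  e_swap (by decide) (by decide) x
theorem sq4 (x : M) : lmul (e 4) (lmul (e 4) x) = -x := e_sq (by decide) x
theorem sw41 (x : M) : lmul (e 4) (lmul (e 1) x) = -lmul (e 1) (lmul (e 4) x) :=
  e_swap (by decide) (by decide) x
theorem sw42 (x : M) : lmul (e 4) (lmul (e 2) x) = -lmul (e 2) (lmul (e 4) x) :=
  e_swap (by decide) (by decide) x
theorem sw43 (x : M) : lmul (e 4) (lmul (e 3) x) = -lmul (e 3) (lmul (e 4) x) :=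
  e_swap (by decide) (by decide) x
theorem sq5 (x : M) : lmul (e 5) (lmul (e 5) x) = -x := e_sq (by decide) x
theorem sw51 (x : M) : lmul (e 5) (lmul (e 1) x) = -lmul (e 1) (lmul (e 5) x) :=
  e_swap (by decide) (by decide) x
theorem sw52 (x : M) : lmul (e 5) (lmul (e 2) x) = -lmul (e 2) (lmul (e 5) x) :=
  e_swap (by decide) (by decide) x
theorem sw53 (x : M) : lmul (e 5) (lmul (e 3) x) = -lmul (e 3) (lmul (e 5) x) :=
  e_swap (by decide) (by decide) x
theorem sw54 (x : M) : lmul (e 5) (lmul (e 4) x) = -lmul (e 4) (lmul (e 5) x) :=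
  e_swap (by decide) (by decide) x
theorem sq6 (x : M) : lmul (e 6) (lmul (e 6) x) = -x := e_sq (by decide) x
theorem sw61 (x : M) : lmul (e 6) (lmul (e 1) x) = -lmul (e 1) (lmul (e 6) x) :=
  e_swap (by decide) (by decide) x
theorem sw62 (x : M) : lmul (e 6) (lmul (e 2) x) = -lmul (e 2) (lmul (e 6) x) :=
  e_swap (by decide) (by decide) x
theorem sw63 (x : M) : lmul (e 6) (lmul (e 3) x) = -lmul (e 3) (lmul (e 6) x) :=
  e_swap (by decide) (by decide) x
theorem sw64 (x : M) : lmul (e 6) (lmul (e 4) x) = -lmul (e 4) (lmul (e 6) x) :=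
  e_swap (by decide) (by decide) x
theorem sw65 (x : M) : lmul (e 6) (lmul (e 5) x) = -lmul (e 5) (lmul (e 6) x) :=
  e_swap (by decide) (by decide) x
theorem sq7 (x : M) : lmul (e 7) (lmul (e 7) x) = -x := e_sq (by decide) x
theorem sw71 (x : M) : lmul (e 7) (lmul (e 1) x) = -lmul (e 1) (lmul (e 7) x) :=
  e_swap (by decide) (by decide) x
theorem sw72 (x : M) : lmul (e 7) (lmul (e 2) x) = -lmul (e 2) (lmul (e 7) x) :=
  e_swap (by decide) (by decide) x
theorem sw73 (x : M) : lmul (e 7) (lmul (e 3) x) = -lmul (e 3) (lmul (e 7) x) :=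
  e_swap (by decide) (by decide) x
theorem sw74 (x : M) : lmul (e 7) (lmul (e 4) x) = -lmul (e 4) (lmul (e 7) x) :=
  e_swap (by decide) (by decide) x
theorem sw75 (x : M) : lmul (e 7) (lmul (e 5) x) = -lmul (e 5) (lmul (e 7) x) :=
  e_swap (by decide) (by decide) x
theorem sw76 (x : M) : lmul (e 7) (lmul (e 6) x) = -lmul (e 6) (lmul (e 7) x) :=
  e_swap (by decide) (by decide) x

/-- The product of all seven left multiplications by imaginary units. -/
noncomputable def vol (x : M) : M :=
  lmul (e 1) (lmul (e 2) (lmul (e 3) (lmul (e 4) (lmul (e 5) (lmul (e 6) (lmul (e 7) x))))))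

theorem vol_fix (x : M) : vol (rmul (e 1) x + lmul (e 1) x) = rmul (e 1) x + lmul (e 1) x := by
  have h1 := qt123.rot.rot.fix x
  have h2 := qt145.rot.rot.fix x
  have h3 := qt167.rot.rot.fix x
  set y := rmul (e 1) x + lmul (e 1) x
  have h : vol y = -lmul (e 3) (lmul (e 1) (lmul (e 2) (lmul (e 5) (lmul (e 1) (lmul (e 4) (lmul (e 7) (lmul (e 1) (lmul (e 6) y)))))))) := by
    simp only [vol, sq1, sq2, sw21, sq3, sw31, sw32, sq4, sw41, sw42, sw43, sq5, sw51, sw52, sw53, sw54, sq6, sw61, sw62, sw63, sw64, sw65, sq7, sw71, sw72, sw73, sw74, sw75, sw76, map_neg, neg_neg]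
  rw [h, h3, map_neg, map_neg, map_neg, h2, map_neg, map_neg, map_neg, map_neg, map_neg, map_neg, h1]
  simp only [neg_neg]

theorem vol_eq (x : M) : vol x = x := by
  have hsub : ∀ a b : M, vol (a - b) = vol a - vol b := fun a b => by simp only [vol, map_sub]
  have hadd : ∀ a b : M, vol (a + b) = vol a + vol b := fun a b => by simp only [vol, map_add]
  have hl : ∀ (i : Fin 8) (a : M), vol (lmul (e i) a) = lmul (e i) (vol a) := by
    intro i a
    fin_cases i
    · have h1 : ∀ z : M, lmul (e 0) z = z := one_lmul
      simp [h1]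
    all_goals simp [vol, sq1, sq2, sw21, sq3, sw31, sw32, sq4, sw41, sw42, sw43, sq5, sw51, sw52, sw53, sw54, sq6, sw61, sw62, sw63, sw64, sw65, sq7, sw71, sw72, sw73, sw74, sw75, sw76, map_neg, neg_neg]
  have hr : ∀ a : M, vol (rmul (e 1) a) = rmul (e 1) a + lmul (e 1) a - lmul (e 1) (vol a) := by
    intro a
    have := vol_fix a
    rw [hadd, hl] at this
    rw [← this, add_sub_cancel_right]
  have key : ∀ a : M, lmul (e 3) (a - vol a) = -lmul (e 1) (lmul (e 2) (a - vol a)) := by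
    intro a
    have h1 := assoc_mid (e 1) (e 2) a
    rw [qt123.pq] at h1
    have h2 := congrArg vol h1
    simp only [hsub, hl, hr] at h2
    simp only [map_add, map_sub, sw21] at h2 ⊢
    linear_combination (norm := module) h1 - h2
  have k1 := key x
  have k2 := key (lmul (e 4) x)
  rw [hl, ← map_sub] at k2
  set z := x - vol x with hz
  have k3 := congrArg (lmul (e 4)) k1
  simp only [map_neg, sw41, sw42, sw43, neg_neg] at k2 k3
  have k4 : (2 : ℝ) • lmul (e 3) (lmul (e 4) z) = 0 := by
    linear_combination (norm := module) k2 - k3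
  have k5 := (smul_eq_zero.1 k4).resolve_left (by norm_num)
  have k6 := congrArg (fun a => lmul (e 4) (lmul (e 3) a)) k5
  simp only [sq3, map_neg, sq4, neg_neg, map_zero] at k6
  rw [hz] at k6
  exact (sub_eq_zero.1 k6).symm

end Theory
end OctBimodule

namespace OctBimodule

section Decomposition

variable {M : Type*} [AddCommGroup M] [Module ℝ M] [OctBimodule M]

set_option linter.unusedSimpArgs false

theorem q4567 (x : M) : lmul (e 4) (lmul (e 5) (lmul (e 6) (lmul (e 7) x))) = lmul (e 1) (lmul (e 2) (lmul (e 3) x)) := by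
  have h := congrArg (fun a => lmul (e 1) (lmul (e 2) (lmul (e 3) a))) (vol_eq x)
  simp only [vol, sq1, sq2, sw21, sq3, sw31, sw32, sq4, sw41, sw42, sw43, sq5, sw51, sw52, sw53, sw54, sq6, sw61, sw62, sw63, sw64, sw65, sq7, sw71, sw72, sw73, sw74, sw75, sw76, map_neg, neg_neg] at h
  exact h

theorem q2367 (x : M) : lmul (e 2) (lmul (e 3) (lmul (e 6) (lmul (e 7) x))) = lmul (e 1) (lmul (e 4) (lmul (e 5) x)) := by
  have h := congrArg (fun a => lmul (e 1) (lmul (e 4) (lmul (e 5) a))) (vol_eq x)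
  simp only [vol, sq1, sq2, sw21, sq3, sw31, sw32, sq4, sw41, sw42, sw43, sq5, sw51, sw52, sw53, sw54, sq6, sw61, sw62, sw63, sw64, sw65, sq7, sw71, sw72, sw73, sw74, sw75, sw76, map_neg, neg_neg] at h
  exact h

theorem q2345 (x : M) : lmul (e 2) (lmul (e 3) (lmul (e 4) (lmul (e 5) x))) = lmul (e 1) (lmul (e 6) (lmul (e 7) x)) := by
  have h := congrArg (fun a => lmul (e 1) (lmul (e 6) (lmul (e 7) a))) (vol_eq x)
  simp only [vol, sq1, sq2, sw21, sq3, sw31, sw32, sq4, sw41, sw42, sw43, sq5, sw51, sw52, sw53, sw54, sq6, sw61, sw62, sw63, sw64, sw65, sq7, sw71, sw72, sw73, sw74, sw75, sw76, map_neg, neg_neg] at h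
  exact h

theorem q1357 (x : M) : lmul (e 1) (lmul (e 3) (lmul (e 5) (lmul (e 7) x))) = lmul (e 2) (lmul (e 4) (lmul (e 6) x)) := by
  have h := congrArg (fun a => lmul (e 2) (lmul (e 4) (lmul (e 6) a))) (vol_eq x)
  simp only [vol, sq1, sq2, sw21, sq3, sw31, sw32, sq4, sw41, sw42, sw43, sq5, sw51, sw52, sw53, sw54, sq6, sw61, sw62, sw63, sw64, sw65, sq7, sw71, sw72, sw73, sw74, sw75, sw76, map_neg, neg_neg] at h
  exact h

theorem q1346 (x : M) : lmul (e 1) (lmul (e 3) (lmul (e 4) (lmul (e 6) x))) = lmul (e 2) (lmul (e 5) (lmul (e 7) x)) := by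
  have h := congrArg (fun a => lmul (e 2) (lmul (e 5) (lmul (e 7) a))) (vol_eq x)
  simp only [vol, sq1, sq2, sw21, sq3, sw31, sw32, sq4, sw41, sw42, sw43, sq5, sw51, sw52, sw53, sw54, sq6, sw61, sw62, sw63, sw64, sw65, sq7, sw71, sw72, sw73, sw74, sw75, sw76, map_neg, neg_neg] at h
  exact h

theorem q1256 (x : M) : lmul (e 1) (lmul (e 2) (lmul (e 5) (lmul (e 6) x))) = lmul (e 3) (lmul (e 4) (lmul (e 7) x)) := by
  have h := congrArg (fun a => lmul (e 3) (lmul (e 4) (lmul (e 7) a))) (vol_eq x)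
  simp only [vol, sq1, sq2, sw21, sq3, sw31, sw32, sq4, sw41, sw42, sw43, sq5, sw51, sw52, sw53, sw54, sq6, sw61, sw62, sw63, sw64, sw65, sq7, sw71, sw72, sw73, sw74, sw75, sw76, map_neg, neg_neg] at h
  exact h

theorem q1247 (x : M) : lmul (e 1) (lmul (e 2) (lmul (e 4) (lmul (e 7) x))) = lmul (e 3) (lmul (e 5) (lmul (e 6) x)) := by
  have h := congrArg (fun a => lmul (e 3) (lmul (e 5) (lmul (e 6) a))) (vol_eq x)
  simp only [vol, sq1, sq2, sw21, sq3, sw31, sw32, sq4, sw41, sw42, sw43, sq5, sw51, sw52, sw53, sw54, sq6, sw61, sw62, sw63, sw64, sw65, sq7, sw71, sw72, sw73, sw74, sw75, sw76, map_neg, neg_neg] at h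
  exact h

/-- The projection onto the nucleus, written with left multiplications only. -/
noncomputable def proj (x : M) : M :=
  (1 / 8 : ℝ) • (x
    - lmul (e 1) (lmul (e 2) (lmul (e 3) x))
    - lmul (e 1) (lmul (e 4) (lmul (e 5) x))
    - lmul (e 1) (lmul (e 6) (lmul (e 7) x))
    - lmul (e 2) (lmul (e 4) (lmul (e 6) x))
    - lmul (e 2) (lmul (e 7) (lmul (e 5) x))
    - lmul (e 3) (lmul (e 7) (lmul (e 4) x))
    - lmul (e 3) (lmul (e 6) (lmul (e 5) x)))

theorem proj_fix123 (x : M) : lmul (e 1) (lmul (e 2) (lmul (e 3) (proj x))) = -proj x := by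
  simp only [proj, map_smul, map_sub, sq1, sq2, sw21, sq3, sw31, sw32, sq4, sw41, sw42, sw43, sq5, sw51, sw52, sw53, sw54, sq6, sw61, sw62, sw63, sw64, sw65, sq7, sw71, sw72, sw73, sw74, sw75, sw76, map_neg, neg_neg, q4567, q2367, q2345, q1357, q1346, q1256, q1247]
  module

theorem proj_fix145 (x : M) : lmul (e 1) (lmul (e 4) (lmul (e 5) (proj x))) = -proj x := by
  simp only [proj, map_smul, map_sub, sq1, sq2, sw21, sq3, sw31, sw32, sq4, sw41, sw42, sw43, sq5, sw51, sw52, sw53, sw54, sq6, sw61, sw62, sw63, sw64, sw65, sq7, sw71, sw72, sw73, sw74, sw75, sw76, map_neg, neg_neg, q4567, q2367, q2345, q1357, q1346, q1256, q1247]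
  module

theorem proj_fix167 (x : M) : lmul (e 1) (lmul (e 6) (lmul (e 7) (proj x))) = -proj x := by
  simp only [proj, map_smul, map_sub, sq1, sq2, sw21, sq3, sw31, sw32, sq4, sw41, sw42, sw43, sq5, sw51, sw52, sw53, sw54, sq6, sw61, sw62, sw63, sw64, sw65, sq7, sw71, sw72, sw73, sw74, sw75, sw76, map_neg, neg_neg, q4567, q2367, q2345, q1357, q1346, q1256, q1247]
  module

theorem proj_fix246 (x : M) : lmul (e 2) (lmul (e 4) (lmul (e 6) (proj x))) = -proj x := by
  simp only [proj, map_smul, map_sub, sq1, sq2, sw21, sq3, sw31, sw32, sq4, sw41, sw42, sw43, sq5, sw51, sw52, sw53, sw54, sq6, sw61, sw62, sw63, sw64, sw65, sq7, sw71, sw72, sw73, sw74, sw75, sw76, map_neg, neg_neg, q4567, q2367, q2345, q1357, q1346, q1256, q1247]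
  module

theorem proj_fix275 (x : M) : lmul (e 2) (lmul (e 7) (lmul (e 5) (proj x))) = -proj x := by
  simp only [proj, map_smul, map_sub, sq1, sq2, sw21, sq3, sw31, sw32, sq4, sw41, sw42, sw43, sq5, sw51, sw52, sw53, sw54, sq6, sw61, sw62, sw63, sw64, sw65, sq7, sw71, sw72, sw73, sw74, sw75, sw76, map_neg, neg_neg, q4567, q2367, q2345, q1357, q1346, q1256, q1247]
  module

theorem proj_fix374 (x : M) : lmul (e 3) (lmul (e 7) (lmul (e 4) (proj x))) = -proj x := by
  simp only [proj, map_smul, map_sub, sq1, sq2, sw21, sq3, sw31, sw32, sq4, sw41, sw42, sw43, sq5, sw51, sw52, sw53, sw54, sq6, sw61, sw62, sw63, sw64, sw65, sq7, sw71, sw72, sw73, sw74, sw75, sw76, map_neg, neg_neg, q4567, q2367, q2345, q1357, q1346, q1256, q1247]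
  module

theorem proj_fix365 (x : M) : lmul (e 3) (lmul (e 6) (lmul (e 5) (proj x))) = -proj x := by
  simp only [proj, map_smul, map_sub, sq1, sq2, sw21, sq3, sw31, sw32, sq4, sw41, sw42, sw43, sq5, sw51, sw52, sw53, sw54, sq6, sw61, sw62, sw63, sw64, sw65, sq7, sw71, sw72, sw73, sw74, sw75, sw76, map_neg, neg_neg, q4567, q2367, q2345, q1357, q1346, q1256, q1247]
  module

theorem sum_proj (x : M) :
    x = proj x - ∑ i : Fin 7, lmul (e i.succ) (proj (lmul (e i.succ) x)) := by
  simp only [Fin.sum_univ_seven, proj, map_smul, map_sub]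
  simp only [Fin.isValue, show (0 : Fin 7).succ = 1 from rfl, show (1 : Fin 7).succ = 2 from rfl,
    show (2 : Fin 7).succ = 3 from rfl, show (3 : Fin 7).succ = 4 from rfl,
    show (4 : Fin 7).succ = 5 from rfl, show (5 : Fin 7).succ = 6 from rfl,
    show (6 : Fin 7).succ = 7 from rfl, sq1, sq2, sw21, sq3, sw31, sw32, sq4, sw41, sw42, sw43, sq5, sw51, sw52, sw53, sw54, sq6, sw61, sw62, sw63, sw64, sw65, sq7, sw71, sw72, sw73, sw74, sw75, sw76, map_neg, neg_neg]
  module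

theorem QTriple.assoc {p q s : Octonion} (h : QTriple p q s) {y : M}
    (hy : lmul p (lmul q (lmul s y)) = -y) :
    lmul (p * q) y = lmul p (lmul q y) ∧ lmul (q * p) y = lmul q (lmul p y) := by
  have hpq : ∀ z : M, lmul q (lmul p z) = -lmul p (lmul q z) := lmul_anti (by rw [h.qp, h.pq])
  have hqs : ∀ z : M, lmul q (lmul s z) = -lmul s (lmul q z) :=
    lmul_anti (by rw [h.sq, h.qs, neg_neg])
  have hps : ∀ z : M, lmul p (lmul s z) = -lmul s (lmul p z) := lmul_anti (by rw [h.ps, h.sp])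
  have h1 := congrArg (lmul s) hy
  simp only [hqs, hps, map_neg, neg_neg, lmul_sq h.ss, neg_inj] at h1
  rw [h.qp, hpq, h.pq, h1]
  simp

theorem QTriple.rot_fix {p q s : Octonion} (h : QTriple p q s) {y : M}
    (hy : lmul p (lmul q (lmul s y)) = -y) : lmul q (lmul s (lmul p y)) = -y := by
  have hqs : ∀ z : M, lmul q (lmul p z) = -lmul p (lmul q z) := lmul_anti (by rw [h.qp, h.pq])
  have hps : ∀ z : M, lmul s (lmul p z) = -lmul p (lmul s z) :=
    lmul_anti (by rw [h.ps, h.sp, neg_neg])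
  rw [hps, map_neg, hqs, neg_neg, hy]

theorem QTriple.assoc_all {p q s : Octonion} (h : QTriple p q s) {y : M}
    (hy : lmul p (lmul q (lmul s y)) = -y) :
    (lmul (p * q) y = lmul p (lmul q y) ∧ lmul (q * p) y = lmul q (lmul p y)) ∧
    (lmul (q * s) y = lmul q (lmul s y) ∧ lmul (s * q) y = lmul s (lmul q y)) ∧
    (lmul (s * p) y = lmul s (lmul p y) ∧ lmul (p * s) y = lmul p (lmul s y)) :=
  ⟨h.assoc hy, h.rot.assoc (h.rot_fix hy), h.rot.rot.assoc (h.rot.rot_fix (h.rot_fix hy))⟩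

theorem mem_nuc_of_e {y : M} (h : ∀ i j : Fin 8, lmul (e i * e j) y = lmul (e i) (lmul (e j) y)) :
    y ∈ nuc M := by
  intro p q
  rw [sub_eq_zero, eq_sum p, eq_sum q]
  simp only [Finset.sum_mul, Finset.mul_sum, map_sum, LinearMap.sum_apply, smul_mul_assoc,
    mul_smul_comm, map_smul, LinearMap.smul_apply, h, Finset.smul_sum]

theorem proj_mem (x : M) : proj x ∈ nuc M := by
  obtain ⟨⟨a0, b0⟩, ⟨c0, d0⟩, ⟨f0, g0⟩⟩ := qt123.assoc_all (proj_fix123 x)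
  obtain ⟨⟨a1, b1⟩, ⟨c1, d1⟩, ⟨f1, g1⟩⟩ := qt145.assoc_all (proj_fix145 x)
  obtain ⟨⟨a2, b2⟩, ⟨c2, d2⟩, ⟨f2, g2⟩⟩ := qt167.assoc_all (proj_fix167 x)
  obtain ⟨⟨a3, b3⟩, ⟨c3, d3⟩, ⟨f3, g3⟩⟩ := qt246.assoc_all (proj_fix246 x)
  obtain ⟨⟨a4, b4⟩, ⟨c4, d4⟩, ⟨f4, g4⟩⟩ := qt275.assoc_all (proj_fix275 x)
  obtain ⟨⟨a5, b5⟩, ⟨c5, d5⟩, ⟨f5, g5⟩⟩ := qt374.assoc_all (proj_fix374 x)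
  obtain ⟨⟨a6, b6⟩, ⟨c6, d6⟩, ⟨f6, g6⟩⟩ := qt365.assoc_all (proj_fix365 x)
  apply mem_nuc_of_e
  intro i j
  by_cases hi : i = 0
  · subst hi
    rw [← one_eq, one_mul, one_lmul]
  by_cases hj : j = 0
  · subst hj
    rw [← one_eq, mul_one, one_lmul]
  by_cases hij : i = j
  · subst hij
    rw [e_sq hi]
    obtain ⟨k, rfl⟩ := Fin.exists_succ_eq.2 hi
    simp only [e_mul_self, map_neg, LinearMap.neg_apply, one_lmul]
  fin_cases i <;> fin_cases j <;>
    first | exact absurd rfl hi | exact absurd rfl hj | exact absurd rfl hij | assumption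

/-- To prove an additive statement about a bimodule it suffices to consider `p y`, `y` associative. -/
theorem nuc_induction {motive : M → Prop} (h : ∀ p, ∀ y ∈ nuc M, motive (lmul p y))
    (add : ∀ a b, motive a → motive b → motive (a + b)) (x : M) : motive x := by
  rw [sum_proj x, sub_eq_add_neg, ← Finset.sum_neg_distrib]
  apply add
  · have := h 1 _ (proj_mem x)
    rwa [one_lmul] at this
  · apply Finset.sum_induction _ _ add
    · have := h 0 _ (proj_mem x)
      simpa using this
    · intro i _
      have := h (-e i.succ) _ (proj_mem (lmul (e i.succ) x))
      simpa using this

theorem nuc_lmul_lmul {y : M} (hy : y ∈ nuc M) (p q : Octonion) :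
    lmul p (lmul q y) = lmul (p * q) y := (sub_eq_zero.1 (hy p q)).symm

theorem nuc_rmul_lmul {y : M} (hy : y ∈ nuc M) (p q : Octonion) :
    rmul p (lmul q y) = lmul q (rmul p y) :=
  sub_eq_zero.1 ((assoc_mid p q y).symm.trans (hy p q))

theorem nuc_rmul_rmul {y : M} (hy : y ∈ nuc M) (p q : Octonion) :
    rmul q (rmul p y) = rmul (p * q) y :=
  sub_eq_zero.1 ((assoc_right p q y).symm.trans (hy p q))

/-- Associative elements commute with all octonions. -/
theorem nuc_comm {y : M} (hy : y ∈ nuc M) (p : Octonion) : rmul p y = lmul p y := by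
  have h1 : rmul (e 1) y = lmul (e 1) y :=
    qt123.rot.rot.comm_aux qt145.rot.rot
      (e_anti (by decide) (by decide) (by decide)) (e_anti (by decide) (by decide) (by decide)) hy
  have H : ∀ i : Fin 8, rmul (e i) y = lmul (e i) y := by
    intro i
    fin_cases i
    · have h2 := nuc_rmul_rmul hy (e 1) (e 1)
      have hs : e 1 * e 1 = (-1 : Octonion) := e_mul_self 0
      rw [h1, nuc_rmul_lmul hy, h1, nuc_lmul_lmul hy, hs] at h2
      simp only [map_neg, LinearMap.neg_apply, neg_inj] at h2
      exact h2.symm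
    · exact h1
    · exact qt123.comm_aux qt246.rot.rot (e_anti (by decide) (by decide) (by decide))
        (e_anti (by decide) (by decide) (by decide)) hy
    · exact qt123.rot.comm_aux qt374.rot.rot (e_anti (by decide) (by decide) (by decide))
        (e_anti (by decide) (by decide) (by decide)) hy
    · exact qt145.comm_aux qt246 (e_anti (by decide) (by decide) (by decide))
        (e_anti (by decide) (by decide) (by decide)) hy
    · exact qt145.rot.comm_aux qt275.rot (e_anti (by decide) (by decide) (by decide))
        (e_anti (by decide) (by decide) (by decide)) hy
    · exact qt167.comm_aux qt246.rot (e_anti (by decide) (by decide) (by decide))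
        (e_anti (by decide) (by decide) (by decide)) hy
    · exact qt167.rot.comm_aux qt275 (e_anti (by decide) (by decide) (by decide))
        (e_anti (by decide) (by decide) (by decide)) hy
  rw [eq_sum p]
  simp only [map_sum, LinearMap.sum_apply, map_smul, LinearMap.smul_apply, H]

theorem nuc_rmul_lmul' {y : M} (hy : y ∈ nuc M) (p q : Octonion) :
    rmul p (lmul q y) = lmul (q * p) y := by
  rw [nuc_rmul_lmul hy, nuc_comm hy, nuc_lmul_lmul hy]

/-- The real part operator on `p y` with `y` associative. -/
theorem reL_lmul (p : Octonion) {y : M} (hy : y ∈ nuc M) : reL (lmul p y) = p 0 • y := by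
  have h : reL (lmul p y) = lmul ((5 / 12 : ℝ) • p -
      (1 / 12 : ℝ) • ∑ i : Fin 7, e i.succ * p * e i.succ) y := by
    simp only [reL, LinearMap.sub_apply, LinearMap.smul_apply, LinearMap.id_apply,
      LinearMap.sum_apply, LinearMap.comp_apply, nuc_lmul_lmul hy, nuc_rmul_lmul' hy, map_sub,
      map_smul, map_sum]
  rw [h, sum_e_mul_mul_e, map_smul, LinearMap.smul_apply, one_lmul]

theorem reL_nuc {y : M} (hy : y ∈ nuc M) : reL y = y := by
  have := reL_lmul 1 hy
  rw [one_lmul] at this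
  simpa [one_eq, e_apply] using this

theorem reL_mem (x : M) : reL x ∈ nuc M := by
  induction x using nuc_induction with
  | h p y hy => rw [reL_lmul p hy]; exact Submodule.smul_mem _ _ hy
  | add a b ha hb => rw [map_add]; exact Submodule.add_mem _ ha hb

/-- `x = ∑ eᵢ Re (ēᵢ x)`. -/
theorem eq_sum_reL (x : M) : x = ∑ i : Fin 8, lmul (e i) (reL (lmul (conj (e i)) x)) := by
  induction x using nuc_induction with
  | h p y hy =>
    simp only [nuc_lmul_lmul hy, reL_lmul _ hy, mul_conj_e_apply_zero]
    conv_lhs => rw [eq_sum p]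
    simp only [map_sum, LinearMap.sum_apply, map_smul, LinearMap.smul_apply]
  | add a b ha hb =>
    conv_lhs => rw [ha, hb]
    simp only [map_add, Finset.sum_add_distrib]

/-- An element `x` with `Re (p x) = 0` for all `p` vanishes. -/
theorem eq_zero_of_reL {x : M} (h : ∀ p, reL (lmul p x) = 0) : x = 0 := by
  rw [eq_sum_reL x]
  simp [h]

theorem reL_assoc (p q : Octonion) (x : M) : reL (lmul (p * q) x) = reL (lmul p (lmul q x)) := by
  induction x using nuc_induction with
  | h r y hy =>
    simp only [nuc_lmul_lmul hy, reL_lmul _ hy]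
    congr 1
    simp only [mul_apply0, mul_apply1, mul_apply2, mul_apply3, mul_apply4, mul_apply5, mul_apply6,
      mul_apply7]
    ring
  | add a b ha hb => simp only [map_add, ha, hb]

end Decomposition
end OctBimodule

namespace OctBimodule

open scoped TensorProduct

section ParaLinear

variable {M N P : Type*} [AddCommGroup M] [Module ℝ M] [OctBimodule M]
  [AddCommGroup N] [Module ℝ N] [OctBimodule N] [AddCommGroup P] [Module ℝ P] [OctBimodule P]

/-- The second (left) associator `A_p(x, f) = f (p x) - p f(x)`, as a linear map in `x`. -/
noncomputable def secondAssoc (p : Octonion) (f : M →ₗ[ℝ] N) : M →ₗ[ℝ] N :=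
  f ∘ₗ lmul p - lmul p ∘ₗ f

theorem secondAssoc_apply (p : Octonion) (f : M →ₗ[ℝ] N) (x : M) :
    secondAssoc p f x = f (lmul p x) - lmul p (f x) := rfl

/-- The real vector space of left para-linear maps: real linear maps with `Re A_p(x, f) = 0`. -/
noncomputable def paraLinear (M N : Type*) [AddCommGroup M] [Module ℝ M] [OctBimodule M]
    [AddCommGroup N] [Module ℝ N] [OctBimodule N] : Submodule ℝ (M →ₗ[ℝ] N) where
  carrier := {f | ∀ (p : Octonion) (x : M), reL (secondAssoc p f x) = 0}
  add_mem' := by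
    intro f g hf hg p x
    have : secondAssoc p (f + g) x = secondAssoc p f x + secondAssoc p g x := by
      simp only [secondAssoc, LinearMap.sub_apply, LinearMap.comp_apply, LinearMap.add_apply, map_add]
      abel
    rw [this, map_add, hf, hg, add_zero]
  zero_mem' := by
    intro p x
    simp [secondAssoc]
  smul_mem' := by
    intro c f hf p x
    have : secondAssoc p (c • f) x = c • secondAssoc p f x := by
      simp only [secondAssoc, LinearMap.sub_apply, LinearMap.comp_apply, LinearMap.smul_apply,
        map_smul, smul_sub]
    rw [this, map_smul, hf, smul_zero]

/-- The type `Hom_LO(M, N)` of left para-linear maps. -/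
def HomLO (M N : Type*) [AddCommGroup M] [Module ℝ M] [OctBimodule M]
    [AddCommGroup N] [Module ℝ N] [OctBimodule N] : Type _ := paraLinear M N

noncomputable instance : AddCommGroup (HomLO M N) := Submodule.addCommGroup (paraLinear M N)

noncomputable instance : Module ℝ (HomLO M N) := Submodule.module (paraLinear M N)

theorem HomLO.add_val (f g : HomLO M N) : (f + g).1 = f.1 + g.1 := rfl
theorem HomLO.sub_val (f g : HomLO M N) : (f - g).1 = f.1 - g.1 := rfl
theorem HomLO.neg_val (f : HomLO M N) : (-f).1 = -f.1 := rfl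
theorem HomLO.smul_val (c : ℝ) (f : HomLO M N) : (c • f).1 = c • f.1 := rfl

theorem HomLO.ext_val {f g : HomLO M N} (h : ∀ x, f.1 x = g.1 x) : f = g :=
  Subtype.ext (LinearMap.ext h)

theorem mem_paraLinear_iff {f : M →ₗ[ℝ] N} :
    f ∈ paraLinear M N ↔ ∀ (p : Octonion) (x : M), reL (f (lmul p x)) = reL (lmul p (f x)) := by
  constructor
  · intro hf p x
    have := hf p x
    rwa [secondAssoc_apply, map_sub, sub_eq_zero] at this
  · intro hf p x
    rw [secondAssoc_apply, map_sub, hf, sub_self]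

theorem mem_paraLinear_of_nuc {f : M →ₗ[ℝ] N} (h : ∀ p, ∀ y ∈ nuc M, f (lmul p y) = lmul p (f y)) :
    f ∈ paraLinear M N := by
  rw [mem_paraLinear_iff]
  intro p x
  induction x using nuc_induction with
  | h q y hy => rw [nuc_lmul_lmul hy, h _ _ hy, h _ _ hy, reL_assoc]
  | add a b ha hb => simp only [map_add, ha, hb]

theorem HomLO_nuc {f : M →ₗ[ℝ] N} (hf : f ∈ paraLinear M N) (p : Octonion) {y : M} (hy : y ∈ nuc M) :
    f (lmul p y) = lmul p (f y) := by
  have hf' := mem_paraLinear_iff.1 hf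
  rw [← sub_eq_zero]
  apply eq_zero_of_reL
  intro q
  rw [map_sub, map_sub, ← hf', nuc_lmul_lmul hy, hf', reL_assoc, sub_self]

/-- Para-linear maps that agree on associative elements are equal. -/
theorem HomLO_ext {f g : HomLO M N} (h : ∀ y ∈ nuc M, f.1 y = g.1 y) : f = g := by
  apply HomLO.ext_val
  intro x
  induction x using nuc_induction with
  | h q y hy => rw [HomLO_nuc f.2 q hy, HomLO_nuc g.2 q hy, h y hy]
  | add a b ha hb => rw [map_add, map_add, ha, hb]

/-- The left multiplication `(r ⊙ f)(x) = f (x r) + A_r(x, f)`. -/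
noncomputable def homLmulFun (r : Octonion) (f : HomLO M N) : HomLO M N :=
  ⟨f.1 ∘ₗ rmul r + secondAssoc r f.1, by
    apply mem_paraLinear_of_nuc
    intro p y hy
    simp only [secondAssoc, LinearMap.add_apply, LinearMap.sub_apply, LinearMap.comp_apply,
      nuc_rmul_lmul' hy, nuc_comm hy, nuc_lmul_lmul hy, HomLO_nuc f.2 _ hy]
    linear_combination (norm := (simp only [map_sub, map_add]; module)) left_alt p r (f.1 y)⟩

theorem homLmulFun_val (r : Octonion) (f : HomLO M N) (x : M) :
    (homLmulFun r f).1 x = f.1 (rmul r x) + (f.1 (lmul r x) - lmul r (f.1 x)) := rfl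

/-- `homLmulFun` as a bilinear map. -/
noncomputable def homLmul : Octonion →ₗ[ℝ] HomLO M N →ₗ[ℝ] HomLO M N :=
  LinearMap.mk₂ ℝ homLmulFun
    (fun r s f => by
      apply HomLO.ext_val
      intro x
      simp only [homLmulFun_val, HomLO.add_val, LinearMap.add_apply, map_add]
      abel)
    (fun c r f => by
      apply HomLO.ext_val
      intro x
      simp only [homLmulFun_val, HomLO.smul_val, LinearMap.smul_apply, map_smul]
      module)
    (fun r f g => by
      apply HomLO.ext_val
      intro x
      simp only [homLmulFun_val, HomLO.add_val, LinearMap.add_apply, map_add]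
      abel)
    (fun c r f => by
      apply HomLO.ext_val
      intro x
      simp only [homLmulFun_val, HomLO.smul_val, LinearMap.smul_apply, map_smul]
      module)

/-- The right multiplication `(f ⊙ r)(x) = f(x) r - A_r(x, f)`. -/
noncomputable def homRmulFun (r : Octonion) (f : HomLO M N) : HomLO M N :=
  ⟨rmul r ∘ₗ f.1 - secondAssoc r f.1, by
    apply mem_paraLinear_of_nuc
    intro p y hy
    simp only [secondAssoc, LinearMap.sub_apply, LinearMap.comp_apply,
      nuc_lmul_lmul hy, HomLO_nuc f.2 _ hy]
    linear_combination (norm := (simp only [map_sub]; module)) -assoc_mid r p (f.1 y)⟩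

theorem homRmulFun_val (r : Octonion) (f : HomLO M N) (x : M) :
    (homRmulFun r f).1 x = rmul r (f.1 x) - (f.1 (lmul r x) - lmul r (f.1 x)) := rfl

/-- `homRmulFun` as a bilinear map. -/
noncomputable def homRmul : Octonion →ₗ[ℝ] HomLO M N →ₗ[ℝ] HomLO M N :=
  LinearMap.mk₂ ℝ homRmulFun
    (fun r s f => by
      apply HomLO.ext_val
      intro x
      simp only [homRmulFun_val, HomLO.add_val, LinearMap.add_apply, map_add]
      abel)
    (fun c r f => by
      apply HomLO.ext_val
      intro x
      simp only [homRmulFun_val, HomLO.smul_val, LinearMap.smul_apply, map_smul]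
      module)
    (fun r f g => by
      apply HomLO.ext_val
      intro x
      simp only [homRmulFun_val, HomLO.add_val, LinearMap.add_apply, map_add]
      abel)
    (fun c r f => by
      apply HomLO.ext_val
      intro x
      simp only [homRmulFun_val, HomLO.smul_val, LinearMap.smul_apply, map_smul]
      module)

theorem homLmul_nuc (r : Octonion) (f : HomLO M N) {y : M} (hy : y ∈ nuc M) :
    (homLmul r f).1 y = lmul r (f.1 y) := by
  change f.1 (rmul r y) + (f.1 (lmul r y) - lmul r (f.1 y)) = _
  rw [nuc_comm hy, HomLO_nuc f.2 _ hy, sub_self, add_zero]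

theorem homRmul_nuc (r : Octonion) (f : HomLO M N) {y : M} (hy : y ∈ nuc M) :
    (homRmul r f).1 y = rmul r (f.1 y) := by
  change rmul r (f.1 y) - (f.1 (lmul r y) - lmul r (f.1 y)) = _
  rw [HomLO_nuc f.2 _ hy, sub_self, sub_zero]

/-- The `𝕆`-bimodule structure on the para-linear maps. -/
noncomputable instance : OctBimodule (HomLO M N) where
  lmul := homLmul
  rmul := homRmul
  one_lmul f := HomLO_ext fun y hy => by rw [homLmul_nuc _ _ hy, one_lmul]
  left_alt p q f := HomLO_ext fun y hy => by
    simp only [HomLO.sub_val, HomLO.neg_val, LinearMap.sub_apply, LinearMap.neg_apply,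
      homLmul_nuc _ _ hy]
    exact left_alt p q (f.1 y)
  assoc_right p q f := HomLO_ext fun y hy => by
    simp only [HomLO.sub_val, LinearMap.sub_apply, homLmul_nuc _ _ hy, homRmul_nuc _ _ hy]
    exact assoc_right p q (f.1 y)
  assoc_mid p q f := HomLO_ext fun y hy => by
    simp only [HomLO.sub_val, LinearMap.sub_apply, homLmul_nuc _ _ hy, homRmul_nuc _ _ hy]
    exact assoc_mid p q (f.1 y)

theorem lmul_val_nuc (r : Octonion) (f : HomLO M N) {y : M} (hy : y ∈ nuc M) :
    (lmul r f).1 y = lmul r (f.1 y) := homLmul_nuc r f hy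

theorem rmul_val_nuc (r : Octonion) (f : HomLO M N) {y : M} (hy : y ∈ nuc M) :
    (rmul r f).1 y = rmul r (f.1 y) := homRmul_nuc r f hy

theorem apply_mem_nuc {f : HomLO M N} (hf : f ∈ nuc (HomLO M N)) {y : M} (hy : y ∈ nuc M) :
    f.1 y ∈ nuc N := by
  intro p q
  have h := congrArg (fun g : HomLO M N => g.1 y) (sub_eq_zero.1 (hf p q))
  simp only [lmul_val_nuc _ _ hy] at h
  exact sub_eq_zero.2 h

/-- The regular composition `(f ⊚ g)(x) = f (g x) - ∑ⱼ eⱼ Re (f (A_{eⱼ}(x, g)))`. -/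
noncomputable def regComp (f : N →ₗ[ℝ] P) (g : M →ₗ[ℝ] N) : M →ₗ[ℝ] P :=
  f ∘ₗ g - ∑ j : Fin 7, lmul (e j.succ) ∘ₗ reL ∘ₗ f ∘ₗ secondAssoc (e j.succ) g

theorem regComp_apply (f : N →ₗ[ℝ] P) (g : M →ₗ[ℝ] N) (x : M) : regComp f g x =
    f (g x) - ∑ j : Fin 7, lmul (e j.succ) (reL (f (secondAssoc (e j.succ) g x))) := by
  simp [regComp]

theorem regComp_mem {f : N →ₗ[ℝ] P} (hf : f ∈ paraLinear N P) (g : M →ₗ[ℝ] N) :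
    regComp f g ∈ paraLinear M P := by
  have hf' := mem_paraLinear_iff.1 hf
  have hs : ∀ p : Octonion, ∀ x : M, secondAssoc p g x =
      ∑ j : Fin 7, p j.succ • secondAssoc (e j.succ) g x := by
    intro p x
    have h0 : secondAssoc (e 0) g x = 0 := by
      rw [secondAssoc_apply, ← one_eq, one_lmul, one_lmul, sub_self]
    have h1 : secondAssoc p g x = ∑ j : Fin 8, p j • secondAssoc (e j) g x := by
      conv_lhs => rw [eq_sum p]
      simp only [secondAssoc_apply, map_smul, map_sum, LinearMap.smul_apply, LinearMap.sum_apply, smul_sub,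
        Finset.sum_sub_distrib]
    rw [h1, Fin.sum_univ_succ, h0, smul_zero, zero_add]
  have hr0 : ∀ (j : Fin 7) (z : P), reL (lmul (e j.succ) (reL z)) = 0 := fun j z => by
    rw [reL_lmul _ (reL_mem z), e_apply, if_neg (Fin.succ_ne_zero j).symm, zero_smul]
  rw [mem_paraLinear_iff]
  intro p x
  rw [← sub_eq_zero, ← map_sub]
  have hg : g (lmul p x) = lmul p (g x) + secondAssoc p g x := by
    rw [secondAssoc_apply, add_sub_cancel]
  have hm : ∀ (j : Fin 7) (z : P), reL (lmul p (lmul (e j.succ) (reL z))) = -(p j.succ • reL z) := by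
    intro j z
    rw [nuc_lmul_lmul (reL_mem z), reL_lmul _ (reL_mem z), ← neg_smul]
    congr 1
    fin_cases j <;> simp [mul_apply0, e_apply, Fin.ext_iff]
  simp only [regComp_apply, map_sub, map_sum, hr0, hm, Finset.sum_const_zero, sub_zero, hg, map_add,
    hf', Finset.sum_neg_distrib]
  rw [hs p x]
  simp only [map_sum, map_smul]
  abel

theorem regComp_nuc (f : N →ₗ[ℝ] P) (g : HomLO M N) {y : M} (hy : y ∈ nuc M) :
    regComp f g.1 y = f (g.1 y) := by
  have : ∀ p, secondAssoc p g.1 y = 0 := fun p => by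
    rw [secondAssoc_apply, HomLO_nuc g.2 _ hy, sub_self]
  simp [regComp_apply, this]

/-- The regular composition of para-linear maps. -/
noncomputable def homComp (f : HomLO N P) (g : HomLO M N) : HomLO M P :=
  ⟨regComp f.1 g.1, regComp_mem f.2 g.1⟩

theorem homComp_nuc (f : HomLO N P) (g : HomLO M N) {y : M} (hy : y ∈ nuc M) :
    (homComp f g).1 y = f.1 (g.1 y) := regComp_nuc f.1 g hy

/-- The identity as a para-linear map. -/
noncomputable def homId (M : Type*) [AddCommGroup M] [Module ℝ M] [OctBimodule M] : HomLO M M :=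
  ⟨LinearMap.id, mem_paraLinear_of_nuc fun _ _ _ => rfl⟩

/-- The map `h ↦ f ⊚ h` from `Hom_LO(M, N)` to `Hom_LO(M, P)`. -/
noncomputable def homPushLin (M : Type*) [AddCommGroup M] [Module ℝ M] [OctBimodule M]
    (f : HomLO N P) : HomLO M N →ₗ[ℝ] HomLO M P where
  toFun h := homComp f h
  map_add' h k := by
    apply HomLO_ext
    intro y hy
    rw [homComp_nuc _ _ hy, HomLO.add_val, HomLO.add_val, LinearMap.add_apply,
      LinearMap.add_apply, homComp_nuc _ _ hy, homComp_nuc _ _ hy, map_add]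
  map_smul' c h := by
    apply HomLO_ext
    intro y hy
    rw [homComp_nuc _ _ hy, HomLO.smul_val, RingHom.id_apply, HomLO.smul_val,
      LinearMap.smul_apply, LinearMap.smul_apply, homComp_nuc _ _ hy, map_smul]

theorem homPushLin_mem (M : Type*) [AddCommGroup M] [Module ℝ M] [OctBimodule M]
    (f : HomLO N P) : homPushLin M f ∈ paraLinear (HomLO M N) (HomLO M P) := by
  apply mem_paraLinear_of_nuc
  intro p h hh
  apply HomLO_ext
  intro y hy
  have h1 : homPushLin M f (lmul p h) = homComp f (lmul p h) := rfl
  have h2 : homPushLin M f h = homComp f h := rfl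
  rw [h1, h2, homComp_nuc _ _ hy, lmul_val_nuc _ _ hy, lmul_val_nuc _ _ hy, homComp_nuc _ _ hy,
    HomLO_nuc f.2 _ (apply_mem_nuc hh hy)]

/-- The map `h ↦ f ⊚ h` as a para-linear map. -/
noncomputable def homPush (M : Type*) [AddCommGroup M] [Module ℝ M] [OctBimodule M]
    (f : HomLO N P) : HomLO (HomLO M N) (HomLO M P) :=
  ⟨homPushLin M f, homPushLin_mem M f⟩

theorem homPush_apply (f : HomLO N P) (h : HomLO M N) : (homPush M f).1 h = homComp f h := rfl

theorem homPush_comp {Q : Type*} [AddCommGroup Q] [Module ℝ Q] [OctBimodule Q]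
    (g : HomLO P Q) (f : HomLO N P) :
    homPush M (homComp g f) = homComp (homPush M g) (homPush M f) := by
  apply HomLO_ext
  intro h hh
  have h2 : (homComp (homPush M g) (homPush M f)).1 h = homComp g (homComp f h) := by
    rw [homComp_nuc (homPush M g) (homPush M f) hh, homPush_apply, homPush_apply]
  rw [homPush_apply, h2]
  apply HomLO_ext
  intro y hy
  rw [homComp_nuc _ _ hy, homComp_nuc _ _ hy, homComp_nuc _ _ hy,
    homComp_nuc _ _ (apply_mem_nuc hh hy)]

theorem homPush_id : homPush M (homId N) = homId (HomLO M N) := by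
  apply HomLO_ext
  intro h _
  rw [homPush_apply]
  apply HomLO_ext
  intro y hy
  rw [homComp_nuc _ _ hy]
  rfl

end ParaLinear

section Tensor

/-- The real vector space `V ⊗ 𝕆` for a real vector space `V`. -/
def OctExt (V : Type*) [AddCommGroup V] [Module ℝ V] : Type _ := V ⊗[ℝ] Octonion

variable {V : Type*} [AddCommGroup V] [Module ℝ V]

noncomputable instance : AddCommGroup (OctExt V) :=
  TensorProduct.addCommGroup (R := ℝ) (M := V) (N := Octonion)

noncomputable instance : Module ℝ (OctExt V) :=
  TensorProduct.instModule (R := ℝ) (M := V) (N := Octonion)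

namespace OctExt

/-- The pure tensor `v ⊗ q`. -/
noncomputable def tmul : V →ₗ[ℝ] Octonion →ₗ[ℝ] OctExt V := TensorProduct.mk ℝ V Octonion

/-- The linear map out of `V ⊗ 𝕆` given by a bilinear map. -/
noncomputable def lift {N : Type*} [AddCommGroup N] [Module ℝ N]
    (b : V →ₗ[ℝ] Octonion →ₗ[ℝ] N) : OctExt V →ₗ[ℝ] N := TensorProduct.lift b

theorem lift_tmul {N : Type*} [AddCommGroup N] [Module ℝ N]
    (b : V →ₗ[ℝ] Octonion →ₗ[ℝ] N) (v : V) (q : Octonion) : lift b (tmul v q) = b v q :=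
  TensorProduct.lift.tmul v q

theorem induction {motive : OctExt V → Prop} (tmul : ∀ v q, motive (tmul v q))
    (add : ∀ a b, motive a → motive b → motive (a + b)) (x : OctExt V) : motive x := by
  refine TensorProduct.induction_on (motive := motive) x ?_ tmul add
  have h := tmul 0 0
  rw [map_zero] at h
  exact h

/-- The bimodule structure on `V ⊗ 𝕆`: `p (v ⊗ q) = v ⊗ p q` and `(v ⊗ q) p = v ⊗ q p`. -/
noncomputable instance : OctBimodule (OctExt V) where
  lmul := LinearMap.mk₂ ℝ (fun p x => lift (tmul.compl₂ (LinearMap.mul ℝ Octonion p)) x)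
    (fun p q x => by
      induction x using OctExt.induction with
      | tmul v r => simp [lift_tmul]
      | add a b ha hb =>
        rw [map_add (lift _), ha, hb, map_add (lift _), map_add (lift _)]
        abel)
    (fun c p x => by
      induction x using OctExt.induction with
      | tmul v r => simp [lift_tmul]
      | add a b ha hb => simp only [map_add, ha, hb, smul_add])
    (fun p x y => map_add _ _ _) (fun c p x => map_smul _ _ _)
  rmul := LinearMap.mk₂ ℝ (fun p x => lift (tmul.compl₂ ((LinearMap.mul ℝ Octonion).flip p)) x)
    (fun p q x => by
      induction x using OctExt.induction with
      | tmul v r => simp [lift_tmul]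
      | add a b ha hb =>
        rw [map_add (lift _), ha, hb, map_add (lift _), map_add (lift _)]
        abel)
    (fun c p x => by
      induction x using OctExt.induction with
      | tmul v r => simp [lift_tmul]
      | add a b ha hb => simp only [map_add, ha, hb, smul_add])
    (fun p x y => map_add _ _ _) (fun c p x => map_smul _ _ _)
  one_lmul m := by
    induction m using OctExt.induction with
    | tmul v r => simp [lift_tmul]
    | add a b ha hb => rw [map_add, ha, hb]
  left_alt p q m := by
    induction m using OctExt.induction with
    | tmul v r =>
      simp only [LinearMap.mk₂_apply, lift_tmul, LinearMap.compl₂_apply, LinearMap.mul_apply',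
        ← map_sub, ← map_neg, assoc_skew p q r]
    | add a b ha hb => simp only [map_add, add_sub_add_comm, ha, hb, neg_add]
  assoc_right p q m := by
    induction m using OctExt.induction with
    | tmul v r =>
      simp only [LinearMap.mk₂_apply, lift_tmul, LinearMap.compl₂_apply, LinearMap.mul_apply',
        LinearMap.flip_apply, ← map_sub, assoc_cycl p q r]
    | add a b ha hb => simp only [map_add, add_sub_add_comm, ha, hb]
  assoc_mid p q m := by
    induction m using OctExt.induction with
    | tmul v r =>
      simp only [LinearMap.mk₂_apply, lift_tmul, LinearMap.compl₂_apply, LinearMap.mul_apply',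
        LinearMap.flip_apply, ← map_sub, assoc_cycl p q r, assoc_cycl r p q]
    | add a b ha hb => simp only [map_add, add_sub_add_comm, ha, hb]

end OctExt

open OctExt (tmul)

theorem lmul_tmul (p q : Octonion) (v : V) : lmul p (tmul v q) = tmul v (p * q) :=
  OctExt.lift_tmul _ _ _

theorem rmul_tmul (p q : Octonion) (v : V) : rmul p (tmul v q) = tmul v (q * p) :=
  OctExt.lift_tmul _ _ _

theorem tmul_one_mem_nuc (v : V) : tmul v 1 ∈ nuc (OctExt V) := by
  intro p q
  simp only [lmul_tmul, mul_one, sub_self]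

variable {M N X Y Z : Type*} [AddCommGroup M] [Module ℝ M] [OctBimodule M]
  [AddCommGroup N] [Module ℝ N] [OctBimodule N]
  [AddCommGroup X] [Module ℝ X] [OctBimodule X] [AddCommGroup Y] [Module ℝ Y] [OctBimodule Y]
  [AddCommGroup Z] [Module ℝ Z] [OctBimodule Z]

/-- The para-linear extension of `g : V → N` to `V ⊗ 𝕆`, where `V` is identified with the real part
`{v ⊗ 1}` of `V ⊗ 𝕆`: it sends `v ⊗ q = q (v ⊗ 1)` to `q g(v)`. -/
noncomputable def lExt (g : V →ₗ[ℝ] N) : HomLO (OctExt V) N :=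
  ⟨OctExt.lift ((lmul : Octonion →ₗ[ℝ] N →ₗ[ℝ] N).flip ∘ₗ g), by
    rw [mem_paraLinear_iff]
    intro p x
    induction x using OctExt.induction with
    | tmul v q => simp [lmul_tmul, reL_assoc, OctExt.lift_tmul]
    | add a b ha hb => simp only [map_add, ha, hb]⟩

theorem lExt_tmul (g : V →ₗ[ℝ] N) (v : V) (q : Octonion) : (lExt g).1 (tmul v q) = lmul q (g v) :=
  OctExt.lift_tmul _ _ _

theorem HomLO_tensor_ext {f g : HomLO (OctExt V) N}
    (h : ∀ v : V, f.1 (tmul v 1) = g.1 (tmul v 1)) : f = g := by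
  apply HomLO.ext_val
  intro x
  induction x using OctExt.induction with
  | tmul v q =>
    have hq : tmul v q = lmul q (tmul v 1) := by rw [lmul_tmul, mul_one]
    rw [hq, HomLO_nuc f.2 _ (tmul_one_mem_nuc v), HomLO_nuc g.2 _ (tmul_one_mem_nuc v), h]
  | add a b ha hb => rw [map_add, map_add, ha, hb]

/-- The real part operator as a map into the nucleus. -/
noncomputable def reN : M →ₗ[ℝ] nuc M := reL.codRestrict (nuc M) reL_mem

/-- The tensor product of `𝕆`-bimodules. -/
abbrev OTensor (M X : Type*) [AddCommGroup M] [Module ℝ M] [OctBimodule M]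
    [AddCommGroup X] [Module ℝ X] [OctBimodule X] : Type _ :=
  OctExt (nuc M ⊗[ℝ] nuc X)

/-- The element `m ⊗_𝕆 x = ∑ (mᵢ ⊗ xⱼ) ⊗ (eᵢ eⱼ)`, for `m = ∑ eᵢ mᵢ` and `x = ∑ eⱼ xⱼ` with
`mᵢ`, `xⱼ` associative, that is, `mᵢ = Re (ēᵢ m)` and `xⱼ = Re (ēⱼ x)`. -/
noncomputable def otmul (m : M) (x : X) : OTensor M X :=
  ∑ i : Fin 8, ∑ j : Fin 8,
    tmul (reN (lmul (conj (e i)) m) ⊗ₜ[ℝ] reN (lmul (conj (e j)) x)) (e i * e j)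

theorem otmul_nuc (m : nuc M) (x : X) : otmul m.1 x =
    ∑ j : Fin 8, tmul (m ⊗ₜ[ℝ] reN (lmul (conj (e j)) x)) (e j) := by
  have h : ∀ i : Fin 8, reN (lmul (conj (e i)) m.1) = (if i = 0 then m else 0) := by
    intro i
    apply Subtype.ext
    change reL (lmul (conj (e i)) m.1) = _
    have := mul_conj_e_apply_zero 1 i
    rw [mul_one] at this
    rw [reL_lmul _ m.2, this, one_eq, e_apply]
    by_cases hi : i = 0 <;> simp [hi]
  unfold otmul
  rw [Finset.sum_eq_single 0]
  · rw [h, if_pos rfl]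
    simp only [← one_eq, one_mul]
  · intro i _ hi
    simp [h, hi]
  · simp

/-- The map `f_M : Re M ⊗ Re X → M ⊗_𝕆 Y`, `m ⊗ x ↦ m ⊗_𝕆 f(x)`. -/
noncomputable def tensorPre (M : Type*) [AddCommGroup M] [Module ℝ M] [OctBimodule M]
    (f : HomLO X Y) : nuc M ⊗[ℝ] nuc X →ₗ[ℝ] OTensor M Y :=
  TensorProduct.lift (LinearMap.mk₂ ℝ (fun m x => otmul m.1 (f.1 x.1))
    (fun m m' x => by
      simp only [otmul_nuc, TensorProduct.add_tmul, map_add, LinearMap.add_apply,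
        Finset.sum_add_distrib])
    (fun c m x => by
      simp only [otmul_nuc, ← TensorProduct.smul_tmul', map_smul, LinearMap.smul_apply,
        Finset.smul_sum])
    (fun m x x' => by
      simp only [otmul_nuc, Submodule.coe_add, TensorProduct.tmul_add, map_add,
        LinearMap.add_apply, Finset.sum_add_distrib])
    (fun c m x => by
      simp only [otmul_nuc, Submodule.coe_smul, TensorProduct.tmul_smul, map_smul,
        LinearMap.smul_apply, Finset.smul_sum]))

theorem tensorPre_tmul (f : HomLO X Y) (m : nuc M) (x : nuc X) :
    tensorPre M f (m ⊗ₜ[ℝ] x) = otmul m.1 (f.1 x.1) :=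
  TensorProduct.lift.tmul m x

theorem otmul_nuc_lmul (m : nuc M) (p : Octonion) (x : nuc X) :
    otmul m.1 (lmul p x.1) = tmul (m ⊗ₜ[ℝ] x) p := by
  have h : ∀ j : Fin 8, reN (lmul (conj (e j)) (lmul p x.1)) = p j • x := by
    intro j
    apply Subtype.ext
    change reL (lmul (conj (e j)) (lmul p x.1)) = p j • x.1
    rw [nuc_lmul_lmul x.2, reL_lmul _ x.2, mul_conj_e_apply_zero]
  simp only [otmul_nuc, h]
  conv_rhs => rw [eq_sum p]
  simp only [TensorProduct.tmul_smul, map_sum, map_smul, LinearMap.smul_apply]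

/-- The para-linear map `1_M ⊗ f : M ⊗_𝕆 X → M ⊗_𝕆 Y` induced by `f`. -/
noncomputable def tensorMap (M : Type*) [AddCommGroup M] [Module ℝ M] [OctBimodule M]
    (f : HomLO X Y) : HomLO (OTensor M X) (OTensor M Y) :=
  lExt (V := nuc M ⊗[ℝ] nuc X) (N := OTensor M Y) (tensorPre M f)

theorem otmul_nuc_add (m : nuc M) (a b : X) : otmul m.1 (a + b) = otmul m.1 a + otmul m.1 b := by
  simp only [otmul_nuc, TensorProduct.tmul_add, map_add, LinearMap.add_apply,
    Finset.sum_add_distrib]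

theorem tensorMap_otmul (f : HomLO X Y) (m : nuc M) (x : X) :
    (tensorMap M f).1 (otmul m.1 x) = otmul m.1 (f.1 x) := by
  have hl : ∀ (p : Octonion) (a : Y), otmul m.1 (lmul p a) = lmul p (otmul m.1 a) := by
    intro p a
    induction a using nuc_induction with
    | h q y hy =>
      rw [nuc_lmul_lmul hy, otmul_nuc_lmul m _ ⟨y, hy⟩, otmul_nuc_lmul m _ ⟨y, hy⟩, lmul_tmul]
    | add a b ha hb => rw [map_add, otmul_nuc_add, ha, hb, otmul_nuc_add, map_add]
  induction x using nuc_induction with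
  | h p y hy =>
    rw [otmul_nuc_lmul m p ⟨y, hy⟩, tensorMap, lExt_tmul, tensorPre_tmul, HomLO_nuc f.2 _ hy, hl]
  | add a b ha hb => rw [otmul_nuc_add, map_add, ha, hb, map_add, otmul_nuc_add]

theorem tensorMap_tmul_one (f : HomLO X Y) (m : nuc M) (x : nuc X) :
    (tensorMap M f).1 (tmul (m ⊗ₜ[ℝ] x) 1) = otmul m.1 (f.1 x.1) := by
  rw [tensorMap, lExt_tmul, one_lmul, tensorPre_tmul]

theorem tensorMap_ext {f g : HomLO (OTensor M X) N}
    (h : ∀ (m : nuc M) (x : nuc X), f.1 (tmul (m ⊗ₜ[ℝ] x) 1) = g.1 (tmul (m ⊗ₜ[ℝ] x) 1)) :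
    f = g := by
  apply HomLO_tensor_ext
  intro v
  induction v using TensorProduct.induction_on with
  | zero => simp
  | tmul m x => exact h m x
  | add a b ha hb => simp only [map_add, LinearMap.add_apply, ha, hb]

theorem tensorMap_comp (f : HomLO Y Z) (g : HomLO X Y) :
    tensorMap M (homComp f g) = homComp (tensorMap M f) (tensorMap M g) := by
  apply tensorMap_ext
  intro m x
  rw [tensorMap_tmul_one, homComp_nuc _ _ (tmul_one_mem_nuc _), homComp_nuc _ _ x.2,
    tensorMap_tmul_one, tensorMap_otmul]

theorem tensorMap_id : tensorMap M (homId X) = homId (OTensor M X) := by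
  apply tensorMap_ext
  intro m x
  rw [tensorMap_tmul_one]
  have := otmul_nuc_lmul m 1 x
  rwa [one_lmul] at this

end Tensor

end OctBimodule

universe u v w

set_option linter.checkUnivs false in
/-- A non-associative category; `comp g f` is the composite `g f`. -/
structure NonAssocCat where
  Obj : Type v
  Hom : Obj → Obj → Type w
  one : ∀ X, Hom X X
  comp : ∀ {X Y Z}, Hom Y Z → Hom X Y → Hom X Z
  comp_one : ∀ {X Y} (f : Hom X Y), comp f (one X) = f
  one_comp : ∀ {X Y} (f : Hom X Y), comp (one Y) f = f

/-- A covariant functor between non-associative categories. -/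
structure NonAssocFunctor (C D : NonAssocCat.{v, w}) where
  obj : C.Obj → D.Obj
  map : ∀ {X Y}, C.Hom X Y → D.Hom (obj X) (obj Y)
  map_comp : ∀ {X Y Z} (g : C.Hom Y Z) (f : C.Hom X Y), map (C.comp g f) = D.comp (map g) (map f)
  map_one : ∀ X, map (C.one X) = D.one (obj X)

/-- `(F, G)` is an adjoint pair: there are bijections `Hom(F X, Y) → Hom(X, G Y)` that are natural
in `X` and in `Y`. -/
def IsAdjointPair {C D : NonAssocCat.{v, w}} (F : NonAssocFunctor C D) (G : NonAssocFunctor D C) : Prop :=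
  ∃ τ : ∀ (X : C.Obj) (Y : D.Obj), D.Hom (F.obj X) Y ≃ C.Hom X (G.obj Y),
    (∀ (X X' : C.Obj) (Y : D.Obj) (f : C.Hom X' X) (α : D.Hom (F.obj X) Y),
      τ X' Y (D.comp α (F.map f)) = C.comp (τ X Y α) f) ∧
    (∀ (X : C.Obj) (Y Y' : D.Obj) (g : D.Hom Y Y') (α : D.Hom (F.obj X) Y),
      τ X Y' (D.comp g α) = C.comp (G.map g) (τ X Y α))

open OctBimodule

/-- A bundled `𝕆`-bimodule. -/
structure OctBimod where
  carrier : Type u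
  [addCommGroup : AddCommGroup carrier]
  [module : Module ℝ carrier]
  [bimodule : OctBimodule carrier]

namespace OctBimod

attribute [instance] OctBimod.addCommGroup OctBimod.module OctBimod.bimodule

/-- The non-associative category of `𝕆`-bimodules, left para-linear maps and regular compositions. -/
noncomputable def LO : NonAssocCat.{u + 1, u} where
  Obj := OctBimod.{u}
  Hom X Y := HomLO X.carrier Y.carrier
  one X := homId X.carrier
  comp f g := homComp f g
  comp_one {X Y} f := HomLO_ext fun y hy => by rw [homComp_nuc _ _ hy]; rfl
  one_comp {X Y} f := HomLO_ext fun y hy => by rw [homComp_nuc _ _ hy]; rfl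

/-- The bimodule `M ⊗_𝕆 X = (Re M ⊗ Re X) ⊗ 𝕆`. -/
noncomputable abbrev tensor (M X : OctBimod.{u}) : OctBimod.{u} := ⟨OTensor M.carrier X.carrier⟩

/-- The bimodule `Hom_LO(M, Y)`. -/
noncomputable abbrev hom (M Y : OctBimod.{u}) : OctBimod.{u} := ⟨HomLO M.carrier Y.carrier⟩

/-- The functor `M ⊗_𝕆 -` on left para-linear maps. -/
noncomputable def tensorFunctor (M : OctBimod.{u}) : NonAssocFunctor LO.{u} LO.{u} where
  obj X := tensor M X
  map {X Y : OctBimod.{u}} (f : HomLO X.carrier Y.carrier) := tensorMap M.carrier f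
  map_comp {X Y Z : OctBimod.{u}} (g : HomLO Y.carrier Z.carrier) (f : HomLO X.carrier Y.carrier) :=
    tensorMap_comp g f
  map_one (X : OctBimod.{u}) := tensorMap_id (M := M.carrier) (X := X.carrier)

/-- The functor `Hom_LO(M, -)`, sending `f` to `h ↦ f ⊚ h`. -/
noncomputable def homFunctor (M : OctBimod.{u}) : NonAssocFunctor LO.{u} LO.{u} where
  obj Y := hom M Y
  map {X Y : OctBimod.{u}} (f : HomLO X.carrier Y.carrier) := homPush M.carrier f
  map_comp {X Y Z : OctBimod.{u}} (g : HomLO Y.carrier Z.carrier)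
      (f : HomLO X.carrier Y.carrier) := homPush_comp g f
  map_one (X : OctBimod.{u}) := homPush_id (M := M.carrier) (N := X.carrier)

end OctBimod

namespace OctBimodule

open scoped TensorProduct
open _root_.OctBimodule.OctExt (tmul)

section Adjunction

variable {M N X Y Z : Type*} [AddCommGroup M] [Module ℝ M] [OctBimodule M]
  [AddCommGroup N] [Module ℝ N] [OctBimodule N]
  [AddCommGroup X] [Module ℝ X] [OctBimodule X] [AddCommGroup Y] [Module ℝ Y] [OctBimodule Y]
  [AddCommGroup Z] [Module ℝ Z] [OctBimodule Z]
  {V : Type*} [AddCommGroup V] [Module ℝ V]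

/-! A left para-linear map is free data on the real part. If `y` lies in `Re M = nuc M`, then `f (p
y) = p f(y)` (`HomLO_nuc`), and `M` is the direct sum of the `eᵢ Re M`; so `f` is determined by its
restriction to `Re M`. Conversely every real-linear map `g : Re M → N` extends, by `∑ eᵢ mᵢ ↦ ∑ eᵢ
g(mᵢ)`, with no condition on the values of `g`. This gives `Hom_LO(M, N) ≃ Hom_ℝ(Re M, N)`
(`nucExtEquiv`), and likewise `Hom_LO(V ⊗ 𝕆, N) ≃ Hom_ℝ(V, N)` (`lExtEquiv`).

With `V = Re M ⊗ Re X`, the adjunction becomes the ordinary tensor-hom adjunction of real vector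
spaces: `Hom_ℝ(Re M ⊗ Re X, Y)` is `Hom_ℝ(Re X, Hom_ℝ(Re M, Y))`, and both layers of the latter are
turned back into para-linear maps. The result is characterised by `τ(α)(x)(m) = α((m ⊗ x) ⊗ 1)` for
`x` and `m` in the real parts (`tensorHomEquiv_coe_coe`).

The non-associative corrections all vanish on real parts. There the associators `A_p(y, f)` are
zero, so `⊙` acts on values, `(p ⊙ f)(y) = p f(y)` and `(f ⊙ p)(y) = f(y) p`, and the regular
composition is the usual one, `(f ⊚ g)(y) = f(g(y))`. Hence each required identity is checked by
evaluation at real `x` and `m` (`HomLO_HomLO_ext`), where it is a statement about plain composition.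

One point needs more. Naturality in `X` involves `τ(α)(f(x))(m)`, and `f(x)` need not be real even
when `x` is. What is used is `τ(α)(x)(m) = α(m ⊗_𝕆 x)` for real `m` and arbitrary `x`
(`tensorHomEquiv_coe`); the definition of `1_M ⊗ f` through `m ⊗_𝕆 f(x)` is exactly what matches it.
-/

/-! ### Para-linear maps as real-linear maps on real parts -/

theorem reN_lmul (p : Octonion) (y : nuc M) : reN (lmul p y.1) = p 0 • y :=
  Subtype.ext (reL_lmul p y.2)

/-- The linear extension `∑ eᵢ mᵢ ↦ ∑ eᵢ g(mᵢ)` of a map defined on the associative elements. -/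
noncomputable def nucExtLin (g : nuc M →ₗ[ℝ] N) : M →ₗ[ℝ] N :=
  ∑ i : Fin 8, lmul (e i) ∘ₗ g ∘ₗ reN ∘ₗ lmul (conj (e i))

/-- The `i`-th coefficient of `p y` is `Re (ēᵢ p y) = pᵢ y`, so the `i`-th summand is `pᵢ eᵢ g(y)`,
and these add up to `p g(y)`. The value `g y` may be any element of `N`: no associativity in `N`
enters. -/
theorem nucExtLin_lmul (g : nuc M →ₗ[ℝ] N) (p : Octonion) (y : nuc M) :
    nucExtLin g (lmul p y.1) = lmul p (g y) := by
  simp only [nucExtLin, LinearMap.sum_apply, LinearMap.comp_apply, nuc_lmul_lmul y.2, reN_lmul,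
    mul_conj_e_apply_zero, map_smul]
  conv_rhs => rw [eq_sum p]
  simp only [map_sum, LinearMap.sum_apply, map_smul, LinearMap.smul_apply]

theorem nucExtLin_coe (g : nuc M →ₗ[ℝ] N) (y : nuc M) : nucExtLin g y.1 = g y := by
  have h := nucExtLin_lmul g 1 y
  rwa [one_lmul, one_lmul] at h

/-- A para-linear map is the same as a linear map on the associative elements. -/
noncomputable def nucExtEquiv (M N : Type*) [AddCommGroup M] [Module ℝ M] [OctBimodule M]
    [AddCommGroup N] [Module ℝ N] [OctBimodule N] : HomLO M N ≃ₗ[ℝ] (nuc M →ₗ[ℝ] N) where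
  toFun f := f.1 ∘ₗ (nuc M).subtype
  map_add' _ _ := rfl
  map_smul' _ _ := rfl
  -- Para-linearity has to be tested only on products `p y` with `y` real, which is where the
  -- extension is explicit.
  invFun g := ⟨nucExtLin g, mem_paraLinear_of_nuc fun p y hy => by
    rw [nucExtLin_lmul g p ⟨y, hy⟩, nucExtLin_coe g ⟨y, hy⟩]⟩
  left_inv f := HomLO_ext fun y hy => nucExtLin_coe _ ⟨y, hy⟩
  right_inv g := LinearMap.ext fun y => nucExtLin_coe g y

theorem nucExtEquiv_symm_coe (g : nuc M →ₗ[ℝ] N) (y : nuc M) :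
    ((nucExtEquiv M N).symm g).1 y.1 = g y := nucExtLin_coe g y

/-- A para-linear map on `V ⊗ 𝕆` is the same as a linear map on `V`. -/
noncomputable def lExtEquiv (V N : Type*) [AddCommGroup V] [Module ℝ V]
    [AddCommGroup N] [Module ℝ N] [OctBimodule N] : HomLO (OctExt V) N ≃ₗ[ℝ] (V →ₗ[ℝ] N) where
  toFun f := f.1 ∘ₗ tmul.flip 1
  map_add' _ _ := rfl
  map_smul' _ _ := rfl
  invFun g := lExt g
  -- The elements `v ⊗ 1` are associative and `v ⊗ q = q (v ⊗ 1)`, so a para-linear map is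
  -- determined by its values on them; it need not be shown that they exhaust the nucleus of `V ⊗
  -- 𝕆`.
  left_inv f := HomLO_tensor_ext fun v => by
    rw [lExt_tmul, one_lmul]
    rfl
  right_inv g := LinearMap.ext fun v => (lExt_tmul g v 1).trans (one_lmul _)

/-! ### The adjunction isomorphism and its values -/

/-- The adjunction isomorphism `Hom(M ⊗ X, Y) ≃ Hom(X, Hom(M, Y))`. -/
noncomputable def tensorHomEquiv (M X Y : Type*) [AddCommGroup M] [Module ℝ M] [OctBimodule M]
    [AddCommGroup X] [Module ℝ X] [OctBimodule X] [AddCommGroup Y] [Module ℝ Y] [OctBimodule Y] :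
    HomLO (OTensor M X) Y ≃ₗ[ℝ] HomLO X (HomLO M Y) :=
  lExtEquiv (nuc M ⊗[ℝ] nuc X) Y ≪≫ₗ
    (TensorProduct.lift.equiv (RingHom.id ℝ) (nuc M) (nuc X) Y).symm ≪≫ₗ
    -- Currying puts the variable from `Re M` first, as in `M ⊗ X`, whereas the target takes `x`
    -- first; hence the flip. The last two steps extend from `Re M` to `M` in the inner variable and
    -- from `Re X` to `X` in the outer one.
    LinearMap.lflip ≪≫ₗ
    LinearEquiv.congrRight (nucExtEquiv M Y).symm ≪≫ₗ
    (nucExtEquiv X (HomLO M Y)).symm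

/-- Both extensions return the original map on real parts, so only the curried form of the
restriction of `α` is left. Together with `HomLO_HomLO_ext` this formula characterises the
isomorphism, and the later arguments use it in place of the construction. -/
theorem tensorHomEquiv_coe_coe (α : HomLO (OTensor M X) Y) (x : nuc X) (m : nuc M) :
    ((tensorHomEquiv M X Y α).1 x.1).1 m.1 = α.1 (tmul (m ⊗ₜ[ℝ] x) 1) := by
  simp only [tensorHomEquiv, LinearEquiv.trans_apply]
  rw [nucExtEquiv_symm_coe]
  -- The outer extension has been evaluated at `x`; this evaluates the inner one at `m`. Flipping
  -- and currying unfold by definition.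
  exact nucExtEquiv_symm_coe _ m

/-- Two layers of the same principle: a map out of `X` is determined on `Re X`, and each of its
values, being itself para-linear on `M`, is determined on `Re M`. -/
theorem HomLO_HomLO_ext {f g : HomLO X (HomLO M Y)}
    (h : ∀ (x : nuc X) (m : nuc M), (f.1 x.1).1 m.1 = (g.1 x.1).1 m.1) : f = g :=
  HomLO_ext fun x hx => HomLO_ext fun m hm => h ⟨x, hx⟩ ⟨m, hm⟩

/-! ### Compatibility with the bimodule structures -/

/-- Since `(m ⊗ x) ⊗ 1`, `x` and `m` are all associative, each of the three multiplications `⊙`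
involved acts on values, and both sides become `p α((m ⊗ x) ⊗ 1)`. The right multiplication is
handled in the same way. -/
theorem tensorHomEquiv_lmul (p : Octonion) (α : HomLO (OTensor M X) Y) :
    tensorHomEquiv M X Y (lmul p α) = lmul p (tensorHomEquiv M X Y α) :=
  HomLO_HomLO_ext fun x m => by
    rw [tensorHomEquiv_coe_coe, lmul_val_nuc _ _ (tmul_one_mem_nuc _), lmul_val_nuc _ _ x.2,
      lmul_val_nuc _ _ m.2, tensorHomEquiv_coe_coe]

theorem tensorHomEquiv_rmul (p : Octonion) (α : HomLO (OTensor M X) Y) :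
    tensorHomEquiv M X Y (rmul p α) = rmul p (tensorHomEquiv M X Y α) :=
  HomLO_HomLO_ext fun x m => by
    rw [tensorHomEquiv_coe_coe, rmul_val_nuc _ _ (tmul_one_mem_nuc _), rmul_val_nuc _ _ x.2,
      rmul_val_nuc _ _ m.2, tensorHomEquiv_coe_coe]

/-! ### Naturality in both variables -/

/-- Needed because a para-linear map does not preserve real parts in general. Both sides are
additive in `x`, so `x = q y` with `y` real suffices; then `τ(α)(q y) = q ⊙ τ(α)(y)`, whose value at
the real element `m` is `q α((m ⊗ y) ⊗ 1) = α((m ⊗ y) ⊗ q)`, and `(m ⊗ y) ⊗ q` is `m ⊗_𝕆 q y`. -/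
theorem tensorHomEquiv_coe (α : HomLO (OTensor M X) Y) (x : X) (m : nuc M) :
    ((tensorHomEquiv M X Y α).1 x).1 m.1 = α.1 (otmul m.1 x) := by
  induction x using nuc_induction with
  | h q y hy =>
    -- Writing the pure tensor as `q` times an associative element lets `q` be pulled out of `α`.
    have hq : tmul (m ⊗ₜ[ℝ] (⟨y, hy⟩ : nuc X)) q
        = lmul q (tmul (m ⊗ₜ[ℝ] (⟨y, hy⟩ : nuc X)) 1) := by
      rw [lmul_tmul, mul_one]
    rw [HomLO_nuc (tensorHomEquiv M X Y α).2 _ hy, lmul_val_nuc _ _ m.2,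
      tensorHomEquiv_coe_coe α ⟨y, hy⟩, otmul_nuc_lmul m q ⟨y, hy⟩, hq,
      HomLO_nuc α.2 _ (tmul_one_mem_nuc _)]
  | add a b ha hb =>
    rw [map_add, HomLO.add_val, LinearMap.add_apply, ha, hb, otmul_nuc_add, map_add]

/-- On real `x` and `m` both regular compositions are ordinary ones: the left side is `α(m ⊗_𝕆
f(x))` and the right side is `τ(α)(f(x))(m)`. They agree by `tensorHomEquiv_coe` at the possibly
non-real element `f(x)`. -/
theorem tensorHomEquiv_comp_tensorMap (f : HomLO Z X) (α : HomLO (OTensor M X) Y) :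
    tensorHomEquiv M Z Y (homComp α (tensorMap M f)) = homComp (tensorHomEquiv M X Y α) f :=
  HomLO_HomLO_ext fun x m => by
    rw [tensorHomEquiv_coe_coe, homComp_nuc _ _ (tmul_one_mem_nuc _), tensorMap_tmul_one,
      homComp_nuc _ _ x.2, tensorHomEquiv_coe]

/-- Both sides evaluate to `g(α((m ⊗ x) ⊗ 1))`. The right side uses two collapses of `⊚`: the outer
one at the real `x`, then the one inside `g ⊚ τ(α)(x)` at the real `m`. -/
theorem tensorHomEquiv_homComp (g : HomLO Y Z) (α : HomLO (OTensor M X) Y) :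
    tensorHomEquiv M X Z (homComp g α) = homComp (homPush M g) (tensorHomEquiv M X Y α) :=
  HomLO_HomLO_ext fun x m => by
    rw [tensorHomEquiv_coe_coe, homComp_nuc _ _ (tmul_one_mem_nuc _), homComp_nuc _ _ x.2,
      homPush_apply, homComp_nuc _ _ m.2, tensorHomEquiv_coe_coe]

end Adjunction

end OctBimodule

/-! ### The adjoint pair -/

open OctBimod in
theorem mainTheorem2 (M : OctBimod.{u}) :
    IsAdjointPair (tensorFunctor M) (homFunctor M) ∧
    ∃ τ : ∀ X Y : OctBimod.{u},
        HomLO (tensor M X).carrier Y.carrier ≃ₗ[ℝ] HomLO X.carrier (hom M Y).carrier,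
      (∀ (X Y : OctBimod.{u}) (p : Octonion) (α : HomLO (tensor M X).carrier Y.carrier),
        τ X Y (lmul p α) = lmul p (τ X Y α) ∧ τ X Y (rmul p α) = rmul p (τ X Y α)) ∧
      (∀ (X X' Y : OctBimod.{u}) (f : HomLO X'.carrier X.carrier)
          (α : HomLO (tensor M X).carrier Y.carrier),
        τ X' Y (homComp α (tensorMap M.carrier f)) = homComp (τ X Y α) f) ∧
      (∀ (X Y Y' : OctBimod.{u}) (g : HomLO Y.carrier Y'.carrier)
          (α : HomLO (tensor M X).carrier Y.carrier),
        τ X Y' (homComp g α) = homComp (homPush M.carrier g) (τ X Y α)) := by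
  -- One family of isomorphisms serves both claims: its underlying bijections give the adjoint pair.
  -- The explicit types present the objects and morphisms of `LO` as bimodules and para-linear maps.
  refine ⟨⟨fun (X Y : OctBimod.{u}) => (tensorHomEquiv M.carrier X.carrier Y.carrier).toEquiv,
      fun (X X' Y : OctBimod.{u}) (f : HomLO X'.carrier X.carrier)
        (α : HomLO (tensor M X).carrier Y.carrier) => tensorHomEquiv_comp_tensorMap f α,
      fun (X Y Y' : OctBimod.{u}) (g : HomLO Y.carrier Y'.carrier)
        (α : HomLO (tensor M X).carrier Y.carrier) => tensorHomEquiv_homComp g α⟩,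
    fun X Y => tensorHomEquiv M.carrier X.carrier Y.carrier,
    fun X Y p α => ⟨tensorHomEquiv_lmul p α, tensorHomEquiv_rmul p α⟩,
    fun X X' Y f α => tensorHomEquiv_comp_tensorMap f α,
    fun X Y Y' g α => tensorHomEquiv_homComp g α⟩
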